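/- **Theorem 4.1 (Local-in-time existence and uniqueness).** Let $\ell,T,\beta,p,q>0$, $I=(0,\ell)$, and write $X=H^1_0(I)\cap H^2(I)$ with the $H^2(I)$-norm, where $H^1_0(I)$, $H^3_0(I)$ are the functions of $H^1(I)$, $H^3(I)$ that vanish at $0$ and $\ell$, respectively that vanish there together with their first and second derivatives. All spaces are real, $H^m(0,\tau;X)$ is defined through weak derivatives in $L^2(0,\tau;X)$, and values at points are those of the continuous representatives. Assume: (i1) $u_0,u_1\in H^4(I)$ and $\varphi\in H^3_0(I)$. (i2) $u_2=(1-\beta\frac{d^2}{dx^2})^{-1}u_0''$, meaning that $u_2\in H^2(I)$ and $u_2-\beta u_2''=u_0''$ on $I$ (no boundary condition is imposed on $u_2$ by this relation), and $v_0(x):=u_1(x)-u_1(\ell)\frac{x}{\ell}$, $v_1(x):=u_2(x)-u_2(\ell)\frac{x}{\ell}$ belong to $X$. (i3) $\int_0^\ell\varphi'(x)u_0''(x)\,dx\neq0$; put $\alpha:=\big(\int_0^\ell\varphi' u_0''\,dx\big)^{-1}$. (i4) $f\in H^4(0,T)$ and, with $k_0:=\alpha\big(f'''(0)+\int_0^\ell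 v_0\varphi'''\,dx\big)$, $$\int_0^\ell(\varphi-\beta\varphi'')u_j'\,dx=f^{(j)}(0)\quad(j=0,1,2),\qquad \int_0^\ell(\varphi-\beta\varphi'')\,w\,dx=f'''(0)$$ for some $w\in H^2(I)$ with $w-\beta w''=u_1'''-k_0u_0'''$ on $I$. (i5) $\psi(\ell)\ne0$, where $\psi(x):=\int_0^x\varphi(s)\,ds-\beta\varphi'(x)$; put $$y_2:=\frac1{\psi(\ell)}\Big[f'(0)-k_0f(0)+\int_0^\ell\psi\,(u_1''-k_0u_0'')\,dx\Big].$$ For $v\in H^2(0,\tau;X)$ put $G[v_{xx}](t):=\frac1{\psi(\ell)}\big(f'(t)+\int_0^\ell\psi(x)v_{xx}(x,t)\,dx\big)$, $G'[v_{xx}](t):=\frac1{\psi(\ell)}\big(f''(t)+\int_0^\ell\psi(x)v_{xxt}(x,t)\,dx\big)$, and $\widehat G_0:=\frac1{\psi(\ell)}\big(f(0)+\int_0^\ell\psi u_0''\,dx\big)$. Then there is $\tau\in(0,T)$ such that there is exactly one pair $(v,k)\in H^2(0,\tau;X)\times H^1(0,\tau)$ for which there is $y\in H^3(0,\tau)$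 with $k(0)=k_0$, $y''(0)=y_2$, $v(0)=v_0$, $v_t(0)=v_1$ and, for almost every $t\in(0,\tau)$, $$v_{tt}-v_{xx}-\beta v_{xxtt}+k(t)u_0''+\int_0^tk(t-s)v_{xx}(\cdot,s)\,ds=\big(p\,y'''(t)+q\,y''(t)\big)\frac{x}{\ell}\quad\text{in }L^2(I),$$ $$k'(t)=\alpha\Big\{f^{(iv)}(t)+\int_0^\ell v_t\varphi'''\,dx-k_0\int_0^\ell v\,\varphi'''\,dx-\int_0^t\!\int_0^\ell k'(t-s)v(x,s)\varphi'''(x)\,dx\,ds\Big\},$$ $$y'''(t)=G'[v_{xx}](t)-k'(t)\,\widehat G_0-k_0\,G[v_{xx}](t)-\int_0^tk'(t-s)\,G[v_{xx}](s)\,ds.$$ The boundary conditions $v|_{x=0}=v|_{x=\ell}=0$ are contained in $v(t)\in X$. -/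

import Mathlib

open MeasureTheory Set
open scoped ContDiff

noncomputable section

namespace AcousticInverse

section Sobolev

variable {E : Type*} [NormedAddCommGroup E] [NormedSpace ℝ E]

/-- `g` is the weak derivative of `u` on the interval `(a, b)`. It is only used for functions in
`L²(a, b; E)` with `E` complete, so that all integrals are genuine Bochner integrals. -/
def HasWeakDeriv (a b : ℝ) (u g : ℝ → E) : Prop :=
  ∀ η : ℝ → ℝ, ContDiff ℝ ∞ η → HasCompactSupport η → tsupport η ⊆ Ioo a b →
    ∫ t in Ioo a b, deriv η t • u t = - ∫ t in Ioo a b, η t • g t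

/-- The class `u` of functions on `(a, b)` has a representative that is continuous on `[a, b]`
and takes the value `c` at `x` (for `x ∈ [a, b]` there is at most one such `c` when `a < b`). -/
def HasValueAt (a b : ℝ) (u : ℝ → E) (x : ℝ) (c : E) : Prop :=
  ∃ w : ℝ → E, ContinuousOn w (Icc a b) ∧ w =ᵐ[volume.restrict (Ioo a b)] u ∧ w x = c

open Classical in
/-- The value at `x ∈ [a, b]` of the continuous representative of `u`. -/
def valueAt (a b : ℝ) (u : ℝ → E) (x : ℝ) : E :=
  if h : ∃ c, HasValueAt a b u x c then h.choose else 0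

theorem HasValueAt.add {E : Type*} [NormedAddCommGroup E] {a b x : ℝ} {u v : ℝ → E} {c d : E}
    (hu : HasValueAt a b u x c) (hv : HasValueAt a b v x d) :
    HasValueAt a b (u + v) x (c + d) := by
  obtain ⟨w, hw, hwu, rfl⟩ := hu
  obtain ⟨w', hw', hwv, rfl⟩ := hv
  exact ⟨w + w', hw.add hw', hwu.add hwv, rfl⟩

theorem HasValueAt.smul {a b x : ℝ} {u : ℝ → E} {c : E} (r : ℝ)
    (hu : HasValueAt a b u x c) : HasValueAt a b (r • u) x (r • c) := by
  obtain ⟨w, hw, hwu, rfl⟩ := hu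
  exact ⟨r • w, hw.const_smul r, hwu.const_smul r, rfl⟩

theorem HasValueAt.congr {E : Type*} [NormedAddCommGroup E] {a b x : ℝ} {u v : ℝ → E} {c : E}
    (hu : HasValueAt a b u x c) (h : u =ᵐ[volume.restrict (Ioo a b)] v) :
    HasValueAt a b v x c := by
  obtain ⟨w, hw, hwu, hc⟩ := hu
  exact ⟨w, hw, hwu.trans h, hc⟩

theorem HasWeakDeriv.congr {a b : ℝ} {u v g h : ℝ → E} (H : HasWeakDeriv a b u g)
    (h₁ : u =ᵐ[volume.restrict (Ioo a b)] v) (h₂ : g =ᵐ[volume.restrict (Ioo a b)] h) :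
    HasWeakDeriv a b v h := by
  intro η h1 h2 h3
  have e1 : ∫ t in Ioo a b, deriv η t • v t = ∫ t in Ioo a b, deriv η t • u t :=
    integral_congr_ae (by filter_upwards [h₁] with t ht; rw [ht])
  have e2 : ∫ t in Ioo a b, η t • h t = ∫ t in Ioo a b, η t • g t :=
    integral_congr_ae (by filter_upwards [h₂] with t ht; rw [ht])
  rw [e1, e2, H η h1 h2 h3]

theorem integrable_test_smul {a b : ℝ} (f : Lp E 2 (volume.restrict (Ioo a b))) {η : ℝ → ℝ}
    (hη : Continuous η) (hc : HasCompactSupport η) :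
    Integrable (fun t => η t • f t) (volume.restrict (Ioo a b)) := by
  have hf : Integrable f (volume.restrict (Ioo a b)) :=
    (Lp.memLp f).integrable (by norm_num)
  obtain ⟨C, hC⟩ := hc.exists_bound_of_continuous hη
  exact hf.bdd_smul C hη.aestronglyMeasurable (Filter.Eventually.of_forall hC)

theorem HasWeakDeriv.add {a b : ℝ} {u g v h : Lp E 2 (volume.restrict (Ioo a b))}
    (H : HasWeakDeriv a b u g) (H' : HasWeakDeriv a b v h) :
    HasWeakDeriv a b (u + v : Lp E 2 (volume.restrict (Ioo a b)))
      (g + h : Lp E 2 (volume.restrict (Ioo a b))) := by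
  refine HasWeakDeriv.congr ?_ (Lp.coeFn_add u v).symm (Lp.coeFn_add g h).symm
  intro η h1 h2 h3
  have h1' : Continuous (deriv η) := h1.continuous_deriv (by simp)
  simp only [Pi.add_apply, smul_add]
  rw [integral_add (integrable_test_smul u h1' h2.deriv) (integrable_test_smul v h1' h2.deriv),
    integral_add (integrable_test_smul g h1.continuous h2)
      (integrable_test_smul h h1.continuous h2), H η h1 h2 h3, H' η h1 h2 h3]
  abel

theorem HasWeakDeriv.smul {a b : ℝ} {u g : Lp E 2 (volume.restrict (Ioo a b))} (r : ℝ)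
    (H : HasWeakDeriv a b u g) :
    HasWeakDeriv a b (r • u : Lp E 2 (volume.restrict (Ioo a b)))
      (r • g : Lp E 2 (volume.restrict (Ioo a b))) := by
  refine HasWeakDeriv.congr ?_ (Lp.coeFn_smul r u).symm (Lp.coeFn_smul r g).symm
  intro η h1 h2 h3
  simp only [Pi.smul_apply, smul_comm _ r]
  rw [integral_smul, integral_smul, H η h1 h2 h3, smul_neg]

theorem hasWeakDeriv_zero {a b : ℝ} :
    HasWeakDeriv a b (0 : Lp E 2 (volume.restrict (Ioo a b)))
      (0 : Lp E 2 (volume.restrict (Ioo a b))) := by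
  have h := Lp.coeFn_zero E 2 (volume.restrict (Ioo a b))
  refine HasWeakDeriv.congr (u := 0) (g := 0) ?_ h.symm h.symm
  intro η _ _ _
  simp

variable (E) in
/-- The tuples `(u, u', …, u^{(m)})` of classes in `L²(a, b; E)` in which every entry is the weak
derivative of the preceding one. -/
def sobolevSubmodule (m : ℕ) (a b : ℝ) :
    Submodule ℝ (PiLp 2 (fun _ : Fin (m + 1) => Lp E 2 (volume.restrict (Ioo a b)))) where
  carrier := {d | ∀ j : Fin m, HasWeakDeriv a b (d j.castSucc) (d j.succ)}
  add_mem' := fun h h' j => (h j).add (h' j)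
  zero_mem' := fun _ => hasWeakDeriv_zero
  smul_mem' := fun r _ h j => (h j).smul r

variable (E) in
/-- The Sobolev space `H^m(a, b; E)`, with the norm `(∑_{j ≤ m} ‖∂^j u‖²_{L²(a,b;E)})^{1/2}`:
an element is a class `u ∈ L²(a, b; E)` together with its weak derivatives of order `1, …, m`,
all of them in `L²(a, b; E)`. -/
def SobolevH (m : ℕ) (a b : ℝ) : Type _ := sobolevSubmodule E m a b

instance (m : ℕ) (a b : ℝ) : NormedAddCommGroup (SobolevH E m a b) :=
  inferInstanceAs (NormedAddCommGroup (sobolevSubmodule E m a b))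

instance (m : ℕ) (a b : ℝ) : NormedSpace ℝ (SobolevH E m a b) :=
  inferInstanceAs (NormedSpace ℝ (sobolevSubmodule E m a b))

/-- The weak derivative of order `j ≤ m` of `u ∈ H^m(a, b; E)` (`u` itself for `j = 0`). -/
def wderiv {m : ℕ} {a b : ℝ} (u : SobolevH E m a b) (j : ℕ) (hj : j ≤ m := by omega) :
    Lp E 2 (volume.restrict (Ioo a b)) :=
  u.1 ⟨j, Nat.lt_succ_of_le hj⟩

end Sobolev

/-- The elements of `H^2(0, ℓ)` that vanish at `0` and at `ℓ`. -/
def h01h2Submodule (ℓ : ℝ) : Submodule ℝ (SobolevH ℝ 2 0 ℓ) where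
  carrier := {u | HasValueAt 0 ℓ (wderiv u 0) 0 0 ∧ HasValueAt 0 ℓ (wderiv u 0) ℓ 0}
  add_mem' := by
    rintro u v ⟨h1, h2⟩ ⟨h3, h4⟩
    have e := (Lp.coeFn_add (wderiv u 0) (wderiv v 0)).symm
    have h5 := (h1.add h3).congr e
    have h6 := (h2.add h4).congr e
    rw [add_zero] at h5 h6
    exact ⟨h5, h6⟩
  zero_mem' := by
    have h := (Lp.coeFn_zero ℝ 2 (volume.restrict (Ioo 0 ℓ))).symm
    exact ⟨⟨0, continuousOn_const, h, rfl⟩, ⟨0, continuousOn_const, h, rfl⟩⟩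
  smul_mem' := by
    rintro r u ⟨h1, h2⟩
    have e := (Lp.coeFn_smul r (wderiv u 0)).symm
    have h3 := (h1.smul r).congr e
    have h4 := (h2.smul r).congr e
    rw [smul_zero] at h3 h4
    exact ⟨h3, h4⟩

/-- The space `H^1_0(0, ℓ) ∩ H^2(0, ℓ)`, with the norm of `H^2(0, ℓ)`. -/
def H01H2 (ℓ : ℝ) : Type := h01h2Submodule ℓ

instance (ℓ : ℝ) : NormedAddCommGroup (H01H2 ℓ) :=
  inferInstanceAs (NormedAddCommGroup (h01h2Submodule ℓ))

instance (ℓ : ℝ) : NormedSpace ℝ (H01H2 ℓ) :=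
  inferInstanceAs (NormedSpace ℝ (h01h2Submodule ℓ))

/-- The weak derivative of order `j ≤ 2` in the space variable. -/
def xderiv {ℓ : ℝ} (w : H01H2 ℓ) (j : ℕ) (hj : j ≤ 2 := by omega) :
    Lp ℝ 2 (volume.restrict (Ioo 0 ℓ)) :=
  wderiv w.1 j hj

/-- `φ ∈ H^3_0(0, ℓ)`: `φ`, `φ'` and `φ''` vanish at both ends. -/
def IsH03 {ℓ : ℝ} (φ : SobolevH ℝ 3 0 ℓ) : Prop :=
  ∀ (j : ℕ) (hj : j ≤ 2), HasValueAt 0 ℓ (wderiv φ j) 0 0 ∧ HasValueAt 0 ℓ (wderiv φ j) ℓ 0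

/-- `w ∈ H^2(0, ℓ)` is a function `(1 - β d²/dx²)⁻¹ g`, that is, `w - β w'' = g` on `(0, ℓ)`.
No boundary condition is part of this relation. -/
def IsHelmholtzInverse {ℓ : ℝ} (β : ℝ) (g : ℝ → ℝ) (w : SobolevH ℝ 2 0 ℓ) : Prop :=
  ∀ᵐ x ∂volume.restrict (Ioo 0 ℓ), (wderiv w 0) x - β * (wderiv w 2) x = g x

/-- The data of the problem on `(0, ℓ) × (0, T)`. -/
structure Data (ℓ T : ℝ) where
  /-- dispersion coefficient -/
  β : ℝ
  /-- first boundary coefficient, `z = p y' + q y` -/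
  p : ℝ
  /-- second boundary coefficient -/
  q : ℝ
  /-- initial potential -/
  u₀ : SobolevH ℝ 4 0 ℓ
  /-- initial velocity -/
  u₁ : SobolevH ℝ 4 0 ℓ
  /-- initial acceleration -/
  u₂ : SobolevH ℝ 2 0 ℓ
  /-- initial value of `v` -/
  v₀ : H01H2 ℓ
  /-- initial value of `v_t` -/
  v₁ : H01H2 ℓ
  /-- sensor function -/
  φ : SobolevH ℝ 3 0 ℓ
  /-- measurement -/
  f : SobolevH ℝ 4 0 T

namespace Data

variable {ℓ T : ℝ} (D : Data ℓ T)

/-- `α`, the reciprocal of `∫ φ' u₀''`. -/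
def α : ℝ := (∫ x in (0 : ℝ)..ℓ, (wderiv D.φ 1) x * (wderiv D.u₀ 2) x)⁻¹

/-- `f^{(j)}(0)` for `j ≤ 3`. -/
def fZero (j : ℕ) (hj : j ≤ 3 := by omega) : ℝ := valueAt 0 T (wderiv D.f j) 0

/-- The prescribed value `k(0) = α (f'''(0) + ∫ v₀ φ''')`. -/
def kZero : ℝ := D.α * (D.fZero 3 + ∫ x in (0 : ℝ)..ℓ, (xderiv D.v₀ 0) x * (wderiv D.φ 3) x)

/-- `ψ(x) = ∫_0^x φ - β φ'(x)`. -/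
def ψ (x : ℝ) : ℝ := (∫ s in (0 : ℝ)..x, (wderiv D.φ 0) s) - D.β * valueAt 0 ℓ (wderiv D.φ 1) x

/-- The prescribed value `y''(0)`. -/
def ySecondZero : ℝ :=
  (D.ψ ℓ)⁻¹ * (D.fZero 1 - D.kZero * D.fZero 0
    + ∫ x in (0 : ℝ)..ℓ, D.ψ x * ((wderiv D.u₁ 2) x - D.kZero * (wderiv D.u₀ 2) x))

/-- `Ĝ[u_xx](0) = ψ(ℓ)⁻¹ (f(0) + ∫ ψ u₀'')`. -/
def GHatZero : ℝ := (D.ψ ℓ)⁻¹ * (D.fZero 0 + ∫ x in (0 : ℝ)..ℓ, D.ψ x * (wderiv D.u₀ 2) x)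

/-- `G[v_xx](t) = ψ(ℓ)⁻¹ (f'(t) + ∫ ψ v_xx(⬝, t))`. -/
def G {τ : ℝ} (v : SobolevH (H01H2 ℓ) 2 0 τ) (t : ℝ) : ℝ :=
  (D.ψ ℓ)⁻¹ * ((wderiv D.f 1) t + ∫ x in (0 : ℝ)..ℓ, D.ψ x * (xderiv ((wderiv v 0) t) 2) x)

/-- `G'[v_xx](t) = ψ(ℓ)⁻¹ (f''(t) + ∫ ψ v_xxt(⬝, t))`. -/
def GPrime {τ : ℝ} (v : SobolevH (H01H2 ℓ) 2 0 τ) (t : ℝ) : ℝ :=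
  (D.ψ ℓ)⁻¹ * ((wderiv D.f 2) t + ∫ x in (0 : ℝ)..ℓ, D.ψ x * (xderiv ((wderiv v 1) t) 2) x)

/-- The standing assumptions on the data. -/
structure Admissible : Prop where
  β_pos : 0 < D.β
  p_pos : 0 < D.p
  q_pos : 0 < D.q
  φ_mem : IsH03 D.φ
  u₂_eq : IsHelmholtzInverse D.β (wderiv D.u₀ 2) D.u₂
  v₀_eq : ∀ᵐ x ∂volume.restrict (Ioo 0 ℓ),
    (xderiv D.v₀ 0) x = (wderiv D.u₁ 0) x - valueAt 0 ℓ (wderiv D.u₁ 0) ℓ * (x / ℓ)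
  v₁_eq : ∀ᵐ x ∂volume.restrict (Ioo 0 ℓ),
    (xderiv D.v₁ 0) x = (wderiv D.u₂ 0) x - valueAt 0 ℓ (wderiv D.u₂ 0) ℓ * (x / ℓ)
  φ_u₀ : ∫ x in (0 : ℝ)..ℓ, (wderiv D.φ 1) x * (wderiv D.u₀ 2) x ≠ 0
  f_zero : ∫ x in (0 : ℝ)..ℓ, ((wderiv D.φ 0) x - D.β * (wderiv D.φ 2) x) * (wderiv D.u₀ 1) x
    = D.fZero 0
  f_one : ∫ x in (0 : ℝ)..ℓ, ((wderiv D.φ 0) x - D.β * (wderiv D.φ 2) x) * (wderiv D.u₁ 1) x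
    = D.fZero 1
  f_two : ∫ x in (0 : ℝ)..ℓ, ((wderiv D.φ 0) x - D.β * (wderiv D.φ 2) x) * (wderiv D.u₂ 1) x
    = D.fZero 2
  f_three : ∃ w : SobolevH ℝ 2 0 ℓ,
    IsHelmholtzInverse D.β (fun x => (wderiv D.u₁ 3) x - D.kZero * (wderiv D.u₀ 3) x) w ∧
    ∫ x in (0 : ℝ)..ℓ, ((wderiv D.φ 0) x - D.β * (wderiv D.φ 2) x) * (wderiv w 0) x = D.fZero 3
  ψ_ne : D.ψ ℓ ≠ 0

/-- `(v, k, y)` solves the system on `(0, ℓ) × (0, τ)`. The boundary conditions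
`v = 0` at `x = 0` and `x = ℓ` are part of the space of `v`. -/
structure IsSolution {τ : ℝ} (v : SobolevH (H01H2 ℓ) 2 0 τ) (k : SobolevH ℝ 1 0 τ)
    (y : SobolevH ℝ 3 0 τ) : Prop where
  /-- `v_tt - v_xx - β v_xxtt + k u₀'' + ∫_0^t k(t-s) v_xx(s) ds = z'' x / ℓ`, with
  `z'' = p y''' + q y''`; the time integral is an integral in `L²(0, ℓ)`. -/
  pde : ∀ᵐ t ∂volume.restrict (Ioo 0 τ), ∀ᵐ x ∂volume.restrict (Ioo 0 ℓ),
    (xderiv ((wderiv v 2) t) 0) x - (xderiv ((wderiv v 0) t) 2) x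
      - D.β * (xderiv ((wderiv v 2) t) 2) x
      + (wderiv k 0) t * (wderiv D.u₀ 2) x
      + (∫ s in (0 : ℝ)..t, (wderiv k 0) (t - s) • xderiv ((wderiv v 0) s) 2 :
          Lp ℝ 2 (volume.restrict (Ioo 0 ℓ))) x
    = (D.p * (wderiv y 3) t + D.q * (wderiv y 2) t) * (x / ℓ)
  v_init : HasValueAt 0 τ (wderiv v 0) 0 D.v₀
  vt_init : HasValueAt 0 τ (wderiv v 1) 0 D.v₁
  k_init : HasValueAt 0 τ (wderiv k 0) 0 D.kZero
  k_eq : ∀ᵐ t ∂volume.restrict (Ioo 0 τ),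
    (wderiv k 1) t = D.α * ((wderiv D.f 4) t
      + (∫ x in (0 : ℝ)..ℓ, (xderiv ((wderiv v 1) t) 0) x * (wderiv D.φ 3) x)
      - D.kZero * (∫ x in (0 : ℝ)..ℓ, (xderiv ((wderiv v 0) t) 0) x * (wderiv D.φ 3) x)
      - ∫ s in (0 : ℝ)..t, ∫ x in (0 : ℝ)..ℓ,
          (wderiv k 1) (t - s) * (xderiv ((wderiv v 0) s) 0) x * (wderiv D.φ 3) x)
  y_init : HasValueAt 0 τ (wderiv y 2) 0 D.ySecondZero
  y_eq : ∀ᵐ t ∂volume.restrict (Ioo 0 τ),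
    (wderiv y 3) t = D.GPrime v t - (wderiv k 1) t * D.GHatZero - D.kZero * D.G v t
      - ∫ s in (0 : ℝ)..t, (wderiv k 1) (t - s) * D.G v s

end Data

end AcousticInverse

end

open AcousticInverse

/-! The whole system is an ordinary quadratic Volterra equation in a Banach space, because `1 - β
d²/dx²` with Dirichlet conditions gains exactly the two derivatives that `v_xx` loses. Its inverse
maps `L²` boundedly onto `X = H¹₀ ∩ H²`, so `S w = (1 - β d²/dx²)⁻¹ w''` is bounded on `X`, and the
first equation becomes `v_tt = S v - k a - k * S v + (p y''' + q y'') e` with fixed `a, e ∈ X`. The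
other two equations involve `v` and `v_t` only through the bounded functionals `w ↦ ∫ w φ'''` and `w
↦ ∫ ψ w''`.

Take the state `U = (v, v_t, k, y'', f')` and its time derivative `z`. The equations are triangular
in the components of `z`: `k'` occurs on its own right-hand side only under a convolution, `y'''`
contains `k'`, and `v_tt` contains `y'''`. Substituting in this order gives `z = c + P U + κ(z) * M
U + κ'(U) * M' U` with `U = U₀ + ∫₀ᵗ z`, where `c` depends on `f''` and `f''''` alone. Carrying `f'`
as a component of the state keeps all other coefficients independent of time
(`ReducedSystem.eq_forcing_add_op_iff`).

The right-hand side without `c` is Lipschitz in a causal sense: on an `L¹`-ball its variation at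
time `t` is at most a constant times the `L¹`-distance on `(0, t)` (`VolterraData.norm_op_sub_le`).
For small `τ` this makes the map a contraction for the continuous unknown `w = z - c`
(`VolterraData.exists_solution`). For any two integrable solutions on the same interval Grönwall's
inequality gives equality (`VolterraData.ae_eq_of_solution`), so uniqueness is not restricted to the
ball of the fixed-point argument.

The passage between Sobolev classes and `z` rests on the du Bois-Reymond lemma: a class with an
integrable weak derivative is a primitive of it, and the initial condition fixes the constant. The
inverse of `1 - β d²/dx²` comes from the Lax–Milgram theorem in the variable `w''`. -/

noncomputable section

namespace AcousticInverse

/-! ### Weak derivatives and primitives of integrable functions -/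

section Primitive

variable {E : Type*} [NormedAddCommGroup E] [NormedSpace ℝ E]

theorem intervalIntegral_eq_setIntegral_Ioo {a b : ℝ} (hab : a ≤ b) (f : ℝ → E) :
    ∫ t in a..b, f t = ∫ t in Ioo a b, f t := by
  rw [intervalIntegral.integral_of_le hab, integral_Ioc_eq_integral_Ioo]

theorem intervalIntegrable_of_Ioo {E : Type*} [NormedAddCommGroup E] {a b s t : ℝ} {f : ℝ → E} (hf : IntegrableOn f (Ioo a b))
    (hs : s ∈ Icc a b) (ht : t ∈ Icc a b) : IntervalIntegrable f volume s t := by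
  have h : IntegrableOn f (Icc a b) := by rwa [integrableOn_Icc_iff_integrableOn_Ioo]
  exact (h.mono_set (uIcc_subset_Icc hs ht)).intervalIntegrable

theorem intervalIntegral_congr_ae_Ioo {a b s t : ℝ} {f g : ℝ → E}
    (h : f =ᵐ[volume.restrict (Ioo a b)] g) (hs : s ∈ Icc a b) (ht : t ∈ Icc a b) :
    ∫ x in s..t, f x = ∫ x in s..t, g x := by
  have h' : f =ᵐ[volume.restrict (Icc a b)] g := by
    rwa [Measure.restrict_congr_set Ioo_ae_eq_Icc] at h
  rw [Filter.EventuallyEq, ae_restrict_iff' measurableSet_Icc] at h'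
  refine intervalIntegral.integral_congr_ae ?_
  filter_upwards [h'] with x hx hx'
  exact hx (uIcc_subset_Icc hs ht (uIoc_subset_uIcc hx'))

theorem continuousOn_primitive_Ioo {a b : ℝ} (hab : a ≤ b) {g : ℝ → E}
    (hg : IntegrableOn g (Ioo a b)) : ContinuousOn (fun t => ∫ s in a..t, g s) (Icc a b) := by
  have h : IntegrableOn g (uIcc a b) := by
    rwa [uIcc_of_le hab, integrableOn_Icc_iff_integrableOn_Ioo]
  have := intervalIntegral.continuousOn_primitive_interval h
  rwa [uIcc_of_le hab] at this

/-- Integration by parts for two primitives of integrable functions. -/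
theorem integral_primitive_smul_add [CompleteSpace E] {a b : ℝ} {f : ℝ → ℝ} {g : ℝ → E}
    (hf : IntegrableOn f (Ioo a b)) (hg : IntegrableOn g (Ioo a b)) :
    (∫ t in Ioo a b, (∫ s in a..t, f s) • g t) + ∫ t in Ioo a b, f t • ∫ s in a..t, g s
      = (∫ t in Ioo a b, f t) • ∫ t in Ioo a b, g t := by
  set μ := volume.restrict (Ioo a b) with hμ
  -- Fubini on the square: the two terms are the integrals of `f(s) g(t)` over the triangle `s ≤ t`
  -- and over its complement.
  have hH : Integrable (fun z : ℝ × ℝ => f z.1 • g z.2) (μ.prod μ) := hf.smul_prod hg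
  have hS : MeasurableSet {z : ℝ × ℝ | z.1 ≤ z.2} := measurableSet_le measurable_fst measurable_snd
  have h1 : ∫ t in Ioo a b, (∫ s in a..t, f s) • g t
      = ∫ z, {z : ℝ × ℝ | z.1 ≤ z.2}.indicator (fun z => f z.1 • g z.2) z ∂(μ.prod μ) := by
    rw [integral_prod_symm _ (hH.indicator hS)]
    refine setIntegral_congr_fun measurableSet_Ioo fun t ht => ?_
    have : ∀ s, {z : ℝ × ℝ | z.1 ≤ z.2}.indicator (fun z => f z.1 • g z.2) (s, t)
        = (Iic t).indicator f s • g t := by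
      intro s
      by_cases h : s ≤ t <;> simp [indicator, h]
    simp only [this]
    rw [integral_smul_const, integral_indicator measurableSet_Iic, hμ,
      Measure.restrict_restrict measurableSet_Iic, intervalIntegral.integral_of_le ht.1.le]
    congr 3
    ext s
    simp only [mem_Ioc, mem_inter_iff, mem_Iic, mem_Ioo]
    have := ht.2
    constructor
    · rintro ⟨h1, h2⟩; exact ⟨h2, h1, by linarith⟩
    · rintro ⟨h1, h2, h3⟩; exact ⟨h2, h1⟩
  have h2 : ∫ t in Ioo a b, f t • ∫ s in a..t, g s
      = ∫ z, {z : ℝ × ℝ | z.1 ≤ z.2}ᶜ.indicator (fun z => f z.1 • g z.2) z ∂(μ.prod μ) := by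
    rw [integral_prod _ (hH.indicator hS.compl)]
    refine setIntegral_congr_fun measurableSet_Ioo fun t ht => ?_
    have : ∀ s, {z : ℝ × ℝ | z.1 ≤ z.2}ᶜ.indicator (fun z => f z.1 • g z.2) (t, s)
        = f t • (Iio t).indicator g s := by
      intro s
      by_cases h : t ≤ s
      · simp [indicator, h]
      · simp [indicator, h, not_le.1 h]
    simp only [this]
    rw [integral_smul, integral_indicator measurableSet_Iio, hμ,
      Measure.restrict_restrict measurableSet_Iio, intervalIntegral_eq_setIntegral_Ioo ht.1.le]
    congr 3
    ext s
    simp only [mem_inter_iff, mem_Iio, mem_Ioo]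
    have := ht.2
    constructor
    · rintro ⟨h1, h2⟩; exact ⟨h2, h1, by linarith⟩
    · rintro ⟨h1, h2, h3⟩; exact ⟨h2, h1⟩
  rw [h1, h2, integral_indicator hS, integral_indicator hS.compl, integral_add_compl hS hH,
    integral_prod _ hH]
  simp only [integral_smul]
  rw [integral_smul_const]

theorem integral_deriv_test_Iic {η : ℝ → ℝ} {a b t : ℝ} (hη : ContDiff ℝ ∞ η)
    (hsupp : tsupport η ⊆ Ioo a b) : ∫ s in a..t, deriv η s = η t := by
  have ha : η a = 0 := image_eq_zero_of_notMem_tsupport fun h => (hsupp h).1.false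
  rw [intervalIntegral.integral_deriv_eq_sub, ha, sub_zero]
  · intro x _
    exact hη.differentiable (by simp) x
  · exact (hη.continuous_deriv (by simp)).intervalIntegrable _ _

/-- A primitive of an integrable function has this function as its weak derivative. -/
theorem hasWeakDeriv_of_ae_eq_primitive [CompleteSpace E] {a b : ℝ} {u g : ℝ → E} (C : E)
    (hg : IntegrableOn g (Ioo a b))
    (hu : ∀ᵐ t ∂volume.restrict (Ioo a b), u t = C + ∫ s in a..t, g s) :
    HasWeakDeriv a b u g := by
  rcases le_or_gt b a with hab | hab
  · intro η _ _ _
    simp [Ioo_eq_empty_of_le hab]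
  intro η h1 h2 h3
  have hd : Continuous (deriv η) := h1.continuous_deriv (by simp)
  have hdi : IntegrableOn (deriv η) (Ioo a b) :=
    (hd.integrableOn_Icc (a := a) (b := b)).mono_set Ioo_subset_Icc_self
  have hb : η b = 0 := image_eq_zero_of_notMem_tsupport fun h => (h3 h).2.false
  have hd0 : ∫ t in Ioo a b, deriv η t = 0 := by
    rw [← intervalIntegral_eq_setIntegral_Ioo hab.le, integral_deriv_test_Iic h1 h3, hb]
  have key := integral_primitive_smul_add hdi hg
  rw [hd0, zero_smul] at key
  simp only [integral_deriv_test_Iic h1 h3] at key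
  have hint : IntegrableOn (fun t => deriv η t • ∫ s in a..t, g s) (Ioo a b) := by
    have := (hd.continuousOn.smul (continuousOn_primitive_Ioo hab.le hg)).integrableOn_Icc
      (μ := volume)
    exact this.mono_set Ioo_subset_Icc_self
  have e : ∫ t in Ioo a b, deriv η t • u t
      = ∫ t in Ioo a b, (deriv η t • C + deriv η t • ∫ s in a..t, g s) := by
    refine integral_congr_ae ?_
    filter_upwards [hu] with t ht
    rw [ht, smul_add]
  rw [e, integral_add (hdi.smul_const C) hint, integral_smul_const, hd0, zero_smul, zero_add]
  exact eq_neg_of_add_eq_zero_right key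

/-- The primitive from `a` vanishes to the left of the support of `η` trivially and to the right of
it because `η` has mean zero. Its support therefore stays in the convex hull `[m, M]` of that of
`η`, a compact subset of `(a, b)`. -/
theorem exists_primitive_test {a b : ℝ} {η : ℝ → ℝ} (hη : ContDiff ℝ ∞ η)
    (hsupp : tsupport η ⊆ Ioo a b) (hc : HasCompactSupport η)
    (h0 : ∫ t in Ioo a b, η t = 0) :
    ∃ θ : ℝ → ℝ, ContDiff ℝ ∞ θ ∧ HasCompactSupport θ ∧ tsupport θ ⊆ Ioo a b ∧ deriv θ = η := by
  rcases (tsupport η).eq_empty_or_nonempty with hemp | hne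
  · have : η = 0 := by simpa [tsupport_eq_empty_iff] using hemp
    subst this
    refine ⟨0, contDiff_const, HasCompactSupport.zero, by simp, ?_⟩
    ext x; simp
  have hK : IsCompact (tsupport η) := hc
  obtain ⟨m, hm, hm'⟩ := hK.exists_isLeast hne
  obtain ⟨M, hM, hM'⟩ := hK.exists_isGreatest hne
  have hz : ∀ t, t < m ∨ M < t → η t = 0 := fun t ht =>
    image_eq_zero_of_notMem_tsupport fun h => by
      rcases ht with ht | ht
      · exact absurd (hm' h) (not_le.2 ht)
      · exact absurd (hM' h) (not_le.2 ht)
  have hcont := hη.continuous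
  have hder : ∀ t, HasDerivAt (fun t => ∫ s in a..t, η s) (η t) t := fun t =>
    intervalIntegral.integral_hasDerivAt_right (hcont.intervalIntegrable _ _)
      (hcont.stronglyMeasurableAtFilter _ _) hcont.continuousAt
  have hderiv : deriv (fun t => ∫ s in a..t, η s) = η := funext fun t => (hder t).deriv
  have hma := (hsupp hm).1
  have hMb := (hsupp hM).2
  have hts : tsupport (fun t => ∫ s in a..t, η s) ⊆ Icc m M := by
    refine closure_minimal ?_ isClosed_Icc
    intro t ht
    by_contra hcon
    refine ht ?_
    rw [mem_Icc, not_and_or, not_le, not_le] at hcon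
    rcases hcon with h | h
    · show ∫ s in a..t, η s = 0
      rw [intervalIntegral.integral_congr (g := fun _ => (0 : ℝ))]
      · simp
      · intro s hs
        refine hz s (Or.inl ?_)
        rcases le_total a t with hat | hat
        · rw [uIcc_of_le hat] at hs; exact hs.2.trans_lt h
        · rw [uIcc_of_ge hat] at hs; exact hs.2.trans_lt hma
    · show ∫ s in a..t, η s = 0
      have hab : a ≤ b := by linarith [(hsupp hM).1]
      rw [← intervalIntegral.integral_add_adjacent_intervals (hcont.intervalIntegrable a b)
        (hcont.intervalIntegrable b t), intervalIntegral_eq_setIntegral_Ioo hab, h0, zero_add,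
        intervalIntegral.integral_congr (g := fun _ => (0 : ℝ))]
      · simp
      · intro s hs
        refine hz s (Or.inr ?_)
        rcases le_total b t with hat | hat
        · rw [uIcc_of_le hat] at hs; exact hMb.trans_le hs.1
        · rw [uIcc_of_ge hat] at hs; exact h.trans_le hs.1
  refine ⟨fun t => ∫ s in a..t, η s, ?_, ?_, ?_, hderiv⟩
  · rw [contDiff_infty_iff_deriv]
    exact ⟨fun t => (hder t).differentiableAt, by rwa [hderiv]⟩
  · exact isCompact_Icc.of_isClosed_subset (isClosed_tsupport _) hts
  · exact hts.trans fun t ht => ⟨hma.trans_le ht.1, ht.2.trans_lt hMb⟩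

theorem exists_test_integral_eq_one {a b : ℝ} (hab : a < b) :
    ∃ η : ℝ → ℝ, ContDiff ℝ ∞ η ∧ HasCompactSupport η ∧ tsupport η ⊆ Ioo a b ∧
      ∫ t in Ioo a b, η t = 1 := by
  have hr : 0 < (b - a) / 4 := by linarith
  let f : ContDiffBump ((a + b) / 2 : ℝ) := ⟨(b - a) / 8, (b - a) / 4, by linarith, by linarith⟩
  have hs : tsupport (f.normed volume) ⊆ Ioo a b := by
    rw [f.tsupport_normed_eq, Real.closedBall_eq_Icc]
    intro x hx
    have h1 : (a + b) / 2 - (b - a) / 4 ≤ x := hx.1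
    have h2 : x ≤ (a + b) / 2 + (b - a) / 4 := hx.2
    constructor <;> linarith
  refine ⟨f.normed volume, f.contDiff_normed, f.hasCompactSupport_normed, hs, ?_⟩
  rw [setIntegral_eq_integral_of_forall_compl_eq_zero, f.integral_normed]
  intro x hx
  exact image_eq_zero_of_notMem_tsupport fun h => hx (hs h)

/-- The du Bois-Reymond lemma. -/
theorem HasWeakDeriv.exists_ae_eq_primitive [CompleteSpace E] {a b : ℝ} (hab : a < b)
    {u g : ℝ → E} (H : HasWeakDeriv a b u g) (hu : IntegrableOn u (Ioo a b))
    (hg : IntegrableOn g (Ioo a b)) :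
    ∃ C : E, ∀ᵐ t ∂volume.restrict (Ioo a b), u t = C + ∫ s in a..t, g s := by
  obtain ⟨η₀, h1, h2, h3, h4⟩ := exists_test_integral_eq_one hab
  set P : ℝ → E := fun t => ∫ s in a..t, g s with hP
  have hPi : IntegrableOn P (Ioo a b) :=
    ((continuousOn_primitive_Ioo hab.le hg).integrableOn_Icc).mono_set Ioo_subset_Icc_self
  have HP : HasWeakDeriv a b P g :=
    hasWeakDeriv_of_ae_eq_primitive 0 hg (Filter.Eventually.of_forall fun t => by simp [hP])
  -- `d` has weak derivative zero, so it remains to see that it is constant; its average against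
  -- `η₀` is the only candidate for the constant.
  set d : ℝ → E := fun t => u t - P t with hd
  have hdi : IntegrableOn d (Ioo a b) := hu.sub hPi
  have hint : ∀ {η : ℝ → ℝ} {w : ℝ → E}, Continuous η → HasCompactSupport η →
      IntegrableOn w (Ioo a b) → IntegrableOn (fun t => η t • w t) (Ioo a b) := by
    intro η w hη hc hw
    obtain ⟨K, hK⟩ := hc.exists_bound_of_continuous hη
    exact Integrable.bdd_smul hw K hη.aestronglyMeasurable (Filter.Eventually.of_forall hK)
  have Hd : ∀ η : ℝ → ℝ, ContDiff ℝ ∞ η → HasCompactSupport η → tsupport η ⊆ Ioo a b →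
      ∫ t in Ioo a b, deriv η t • d t = 0 := by
    intro η k1 k2 k3
    have hc' : Continuous (deriv η) := k1.continuous_deriv (by simp)
    simp only [hd, smul_sub]
    rw [integral_sub (hint hc' k2.deriv hu) (hint hc' k2.deriv hPi), H η k1 k2 k3, HP η k1 k2 k3,
      sub_self]
  set C : E := ∫ t in Ioo a b, η₀ t • d t with hC
  refine ⟨C, ?_⟩
  have hdC : IntegrableOn (fun t => d t - C) (Ioo a b) :=
    hdi.sub (integrableOn_const (by simp))
  have main := isOpen_Ioo.ae_eq_zero_of_integral_contDiff_smul_eq_zero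
    (U := Ioo a b) (μ := volume) (f := fun t => d t - C) hdC.locallyIntegrableOn ?_
  · rw [ae_restrict_iff' measurableSet_Ioo]
    filter_upwards [main] with t ht hmem
    have := ht hmem
    simp only [hd] at this
    rw [sub_sub, sub_eq_zero] at this
    rw [this, add_comm]
  intro η k1 k2 k3
  have hzero : ∫ x, η x • (d x - C) = ∫ x in Ioo a b, η x • (d x - C) := by
    rw [setIntegral_eq_integral_of_forall_compl_eq_zero]
    intro x hx
    rw [image_eq_zero_of_notMem_tsupport fun h => hx (k3 h), zero_smul]
  set m := ∫ t in Ioo a b, η t with hm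
  have hηi : IntegrableOn η (Ioo a b) := (k1.continuous.integrable_of_hasCompactSupport k2).integrableOn
  have hη₀i : IntegrableOn η₀ (Ioo a b) :=
    (h1.continuous.integrable_of_hasCompactSupport h2).integrableOn
  -- Removing the multiple `m η₀` leaves a test function of mean zero, hence the derivative of a
  -- test function `θ`, which `d` annihilates.
  have hz1 : ContDiff ℝ ∞ (fun t => η t - m * η₀ t) := k1.sub (contDiff_const.mul h1)
  have hz3 : tsupport (fun t => η t - m * η₀ t) ⊆ tsupport η ∪ tsupport η₀ := by
    refine closure_minimal ?_ ((isClosed_tsupport _).union (isClosed_tsupport _))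
    intro t ht
    by_contra hcon
    rw [mem_union, not_or] at hcon
    refine ht ?_
    simp [image_eq_zero_of_notMem_tsupport hcon.1, image_eq_zero_of_notMem_tsupport hcon.2]
  have hz2 : HasCompactSupport (fun t => η t - m * η₀ t) :=
    (IsCompact.union k2 h2).of_isClosed_subset (isClosed_tsupport _) hz3
  obtain ⟨θ, t1, t2, t3, t4⟩ := exists_primitive_test (a := a) (b := b) hz1
    (hz3.trans (union_subset k3 h3)) hz2 (by
      rw [integral_sub hηi (hη₀i.const_mul m), integral_const_mul, h4, mul_one, sub_self])
  have h5 := Hd θ t1 t2 t3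
  rw [t4] at h5
  have e1 : ∫ t in Ioo a b, (η t - m * η₀ t) • d t
      = (∫ t in Ioo a b, η t • d t) - m • C := by
    simp only [sub_smul, mul_smul]
    rw [integral_sub (hint k1.continuous k2 hdi)
      (Integrable.fun_smul m (hint h1.continuous h2 hdi)), integral_smul]
  rw [e1] at h5
  rw [hzero]
  simp only [smul_sub]
  rw [integral_sub (hint k1.continuous k2 hdi) (hηi.smul_const C), integral_smul_const]
  exact h5

end Primitive

/-! ### Point values of continuous representatives -/

section Values

variable {E : Type*} [NormedAddCommGroup E]

theorem eqOn_Icc_of_ae_eq {a b : ℝ} (hab : a < b) {u w : ℝ → E} (hu : ContinuousOn u (Icc a b))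
    (hw : ContinuousOn w (Icc a b)) (h : u =ᵐ[volume.restrict (Ioo a b)] w) :
    EqOn u w (Icc a b) := by
  have h1 : EqOn u w (Ioo a b) :=
    Measure.eqOn_Ioo_of_ae_eq volume h (hu.mono Ioo_subset_Icc_self)
      (hw.mono Ioo_subset_Icc_self)
  exact h1.of_subset_closure hu hw Ioo_subset_Icc_self (by rw [closure_Ioo hab.ne])

theorem HasValueAt.eq {a b x : ℝ} (hab : a < b) {u w : ℝ → E} {c : E}
    (h : HasValueAt a b u x c) (hx : x ∈ Icc a b) (hw : ContinuousOn w (Icc a b))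
    (hwu : w =ᵐ[volume.restrict (Ioo a b)] u) : w x = c := by
  obtain ⟨w', hw', hwu', rfl⟩ := h
  exact eqOn_Icc_of_ae_eq hab hw hw' (hwu.trans hwu'.symm) hx

theorem valueAt_eq {a b x : ℝ} (hab : a < b) {u w : ℝ → E} (hx : x ∈ Icc a b)
    (hw : ContinuousOn w (Icc a b)) (hwu : w =ᵐ[volume.restrict (Ioo a b)] u) :
    valueAt a b u x = w x := by
  have h : ∃ c, HasValueAt a b u x c := ⟨w x, w, hw, hwu, rfl⟩
  rw [valueAt, dif_pos h]
  exact (h.choose_spec.eq hab hx hw hwu).symm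

end Values

/-! ### Elementary estimates and primitives in `H^m` -/

section SobolevBasics

variable {E : Type*} [NormedAddCommGroup E] [NormedSpace ℝ E] {m : ℕ} {a b : ℝ}

theorem SobolevH.ext {u v : SobolevH E m a b}
    (h : ∀ (j : ℕ) (hj : j ≤ m), wderiv u j hj = wderiv v j hj) : u = v := by
  apply Subtype.ext
  apply PiLp.ext
  intro j
  exact h j (Nat.lt_succ_iff.1 j.2)

/-- The element of `H^m` with prescribed derivatives. -/
def SobolevH.mk (d : Fin (m + 1) → Lp E 2 (volume.restrict (Ioo a b)))
    (h : ∀ j : Fin m, HasWeakDeriv a b (d j.castSucc) (d j.succ)) : SobolevH E m a b :=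
  ⟨WithLp.toLp 2 d, h⟩

theorem hasWeakDeriv_wderiv (u : SobolevH E m a b) (j : ℕ) (hj : j + 1 ≤ m) :
    HasWeakDeriv a b (wderiv u j) (wderiv u (j + 1)) :=
  u.2 ⟨j, hj⟩

theorem norm_wderiv_le (u : SobolevH E m a b) (j : ℕ) (hj : j ≤ m) :
    ‖wderiv u j hj‖ ≤ ‖u‖ :=
  PiLp.norm_apply_le u.1 ⟨j, Nat.lt_succ_of_le hj⟩

theorem SobolevH.norm_le (u : SobolevH E m a b) {C : ℝ} (hC : 0 ≤ C)
    (h : ∀ (j : ℕ) (hj : j ≤ m), ‖wderiv u j hj‖ ≤ C) : ‖u‖ ≤ (m + 1) * C := by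
  have e : ‖u‖ = ‖u.1‖ := rfl
  rw [e, PiLp.norm_eq_of_L2]
  refine Real.sqrt_le_iff.2 ⟨by positivity, ?_⟩
  calc ∑ j, ‖u.1 j‖ ^ 2 ≤ ∑ _j : Fin (m + 1), C ^ 2 := by
        refine Finset.sum_le_sum fun j _ => ?_
        have := h j (Nat.lt_succ_iff.1 j.2)
        exact pow_le_pow_left₀ (norm_nonneg _) this 2
    _ = (m + 1) * C ^ 2 := by simp
    _ ≤ ((m + 1) * C) ^ 2 := by
        have hm : (1 : ℝ) ≤ m + 1 := by linarith [(Nat.cast_nonneg m : (0 : ℝ) ≤ m)]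
        rw [mul_pow]
        refine mul_le_mul_of_nonneg_right ?_ (by positivity)
        nlinarith

theorem integrableOn_Lp {E : Type*} [NormedAddCommGroup E] (f : Lp E 2 (volume.restrict (Ioo a b))) : IntegrableOn f (Ioo a b) :=
  (Lp.memLp f).integrable (by norm_num)

theorem memLp_two_of_continuousOn {E : Type*} [NormedAddCommGroup E] {u : ℝ → E} (hu : ContinuousOn u (Icc a b)) :
    MemLp u 2 (volume.restrict (Ioo a b)) := by
  obtain ⟨C, hC⟩ := isCompact_Icc.exists_bound_of_continuousOn hu
  refine MemLp.of_bound ((hu.mono Ioo_subset_Icc_self).aestronglyMeasurable measurableSet_Ioo) C ?_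
  rw [ae_restrict_iff' measurableSet_Ioo]
  exact Filter.Eventually.of_forall fun t ht => hC t (Ioo_subset_Icc_self ht)

theorem Lp_norm_le_of_ae_bound {E : Type*} [NormedAddCommGroup E] {C : ℝ} (hab : a ≤ b)
    {f : Lp E 2 (volume.restrict (Ioo a b))}
    (hC : 0 ≤ C) (h : ∀ᵐ x ∂volume.restrict (Ioo a b), ‖f x‖ ≤ C) : ‖f‖ ≤ √(b - a) * C := by
  have := Lp.norm_le_of_ae_bound hC h
  refine this.trans_eq ?_
  congr 1
  rw [measureUnivNNReal, Real.sqrt_eq_rpow]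
  simp only [MeasurableSet.univ, Measure.restrict_apply, univ_inter, Real.volume_Ioo,
    ENNReal.toReal_ofNat, one_div]
  rw [ENNReal.coe_toNNReal_eq_toReal, ENNReal.toReal_ofReal (sub_nonneg.2 hab)]

theorem exists_wderiv_ae_eq_primitive [CompleteSpace E] (hab : a < b) (u : SobolevH E m a b)
    (j : ℕ) (hj : j + 1 ≤ m) :
    ∃ C : E, ∀ᵐ t ∂volume.restrict (Ioo a b),
      wderiv u j (by omega) t = C + ∫ s in a..t, wderiv u (j + 1) hj s :=
  (hasWeakDeriv_wderiv u j hj).exists_ae_eq_primitive hab (integrableOn_Lp _) (integrableOn_Lp _)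

/-- The constant from the du Bois-Reymond lemma is found by evaluating the continuous representative
at `a`, where the integral vanishes. -/
theorem wderiv_ae_eq_primitive [CompleteSpace E] (hab : a < b) (u : SobolevH E m a b)
    (j : ℕ) (hj : j + 1 ≤ m) {c : E} (hc : HasValueAt a b (wderiv u j (by omega)) a c) :
    ∀ᵐ t ∂volume.restrict (Ioo a b),
      wderiv u j (by omega) t = c + ∫ s in a..t, wderiv u (j + 1) hj s := by
  obtain ⟨C, hC⟩ := exists_wderiv_ae_eq_primitive hab u j hj
  have h := hc.eq hab (left_mem_Icc.2 hab.le)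
    (continuousOn_const.add (continuousOn_primitive_Ioo hab.le (integrableOn_Lp _)))
    (Filter.EventuallyEq.symm hC)
  simp only [intervalIntegral.integral_same, Pi.add_apply, add_zero] at h
  rwa [← h]

theorem hasValueAt_of_ae_eq_primitive (hab : a ≤ b) {u g : ℝ → E} {c : E}
    (hg : IntegrableOn g (Ioo a b))
    (hu : ∀ᵐ t ∂volume.restrict (Ioo a b), u t = c + ∫ s in a..t, g s) :
    HasValueAt a b u a c :=
  ⟨fun t => c + ∫ s in a..t, g s, continuousOn_const.add (continuousOn_primitive_Ioo hab hg),
    Filter.EventuallyEq.symm hu, by simp⟩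

/-- Hölder's inequality against the constant function `1`. -/
theorem integral_norm_Lp_le {E : Type*} [NormedAddCommGroup E] (hab : a ≤ b) (f : Lp E 2 (volume.restrict (Ioo a b))) :
    ∫ t in Ioo a b, ‖f t‖ ≤ √(b - a) * ‖f‖ := by
  have h1 : IntegrableOn f (Ioo a b) := integrableOn_Lp f
  have h2 := eLpNorm_le_eLpNorm_mul_rpow_measure_univ (μ := volume.restrict (Ioo a b))
    (p := 1) (q := 2) (by norm_num) (Lp.aestronglyMeasurable f)
  rw [Lp.norm_def, integral_norm_eq_lintegral_enorm h1.1, ← eLpNorm_one_eq_lintegral_enorm]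
  have h3 := ENNReal.toReal_mono (ENNReal.mul_ne_top (Lp.eLpNorm_ne_top f) (by
    refine ENNReal.rpow_ne_top_of_nonneg (by norm_num) (by simp))) h2
  refine h3.trans_eq ?_
  rw [ENNReal.toReal_mul, mul_comm]
  congr 1
  rw [← ENNReal.toReal_rpow]
  simp [hab, Real.sqrt_eq_rpow]
  norm_num

end SobolevBasics

/-! ### The space `H¹₀ ∩ H²` and the Dirichlet inverse of `1 - β d²/dx²` -/

section SpaceX

variable {ℓ : ℝ}

/-- The spatial derivative of order `j` as a bounded operator. -/
def xderivCLM (ℓ : ℝ) (j : ℕ) (hj : j ≤ 2 := by omega) :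
    H01H2 ℓ →L[ℝ] Lp ℝ 2 (volume.restrict (Ioo 0 ℓ)) :=
  LinearMap.mkContinuous
    { toFun := fun w => xderiv w j hj
      map_add' := fun _ _ => rfl
      map_smul' := fun _ _ => rfl } 1 fun w => by
    rw [one_mul]
    exact norm_wderiv_le w.1 j hj

/-- The condition at `0` removes the constant in `w`, and the condition at `ℓ` then says that `w'`
has mean zero. The remaining constant `C` is the value of `w'` at `0`. -/
theorem H01H2.ae_eq_primitive (hℓ : 0 < ℓ) (w : H01H2 ℓ) :
    ∃ C : ℝ, (∀ᵐ x ∂volume.restrict (Ioo 0 ℓ),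
        (xderiv w 0) x = ∫ s in (0 : ℝ)..x, (xderiv w 1) s) ∧
      (∀ᵐ x ∂volume.restrict (Ioo 0 ℓ),
        (xderiv w 1) x = C + ∫ s in (0 : ℝ)..x, (xderiv w 2) s) ∧
      ∫ s in (0 : ℝ)..ℓ, (xderiv w 1) s = 0 := by
  obtain ⟨C, hC⟩ := exists_wderiv_ae_eq_primitive hℓ w.1 1 le_rfl
  have hv : HasValueAt 0 ℓ (xderiv w 0) 0 0 := w.2.1
  have hv' : HasValueAt 0 ℓ (xderiv w 0) ℓ 0 := w.2.2
  have h0 : ∀ᵐ x ∂volume.restrict (Ioo 0 ℓ),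
      (xderiv w 0) x = ∫ s in (0 : ℝ)..x, (xderiv w 1) s := by
    have := wderiv_ae_eq_primitive hℓ w.1 0 (by norm_num) hv
    filter_upwards [this] with x hx
    exact hx.trans (zero_add _)
  refine ⟨C, h0, hC, ?_⟩
  have hc : ContinuousOn (fun x => ∫ s in (0 : ℝ)..x, (xderiv w 1) s) (Icc 0 ℓ) :=
    continuousOn_primitive_Ioo hℓ.le (integrableOn_Lp _)
  exact hv'.eq hℓ (right_mem_Icc.2 hℓ.le) hc (Filter.EventuallyEq.symm h0)

theorem abs_primitive_le {g : ℝ → ℝ} (hg : IntegrableOn g (Ioo 0 ℓ)) {x : ℝ}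
    (hx : x ∈ Icc 0 ℓ) : |∫ s in (0 : ℝ)..x, g s| ≤ ∫ s in Ioo 0 ℓ, ‖g s‖ := by
  rw [intervalIntegral_eq_setIntegral_Ioo hx.1, ← Real.norm_eq_abs]
  refine (norm_integral_le_integral_norm _).trans ?_
  exact setIntegral_mono_set hg.norm (Filter.Eventually.of_forall fun _ => norm_nonneg _)
    (Ioo_subset_Ioo_right hx.2).eventuallyLE

/-- A Poincaré estimate. Since `w'` has mean zero, `C` is minus the mean of the primitive of `w''`,
which is bounded by `m = √ℓ ‖w''‖`. Hence `|w'| ≤ 2m` and `|w| ≤ 2mℓ`; the factor `3` counts the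
derivatives of order `0, 1, 2`. -/
theorem H01H2.norm_le (hℓ : 0 < ℓ) (w : H01H2 ℓ) :
    ‖w‖ ≤ 3 * ((1 + 2 * √ℓ * √ℓ * (1 + ℓ)) * ‖xderiv w 2‖) := by
  obtain ⟨C, h0, h1, hz⟩ := w.ae_eq_primitive hℓ
  set m := √ℓ * ‖xderiv w 2‖ with hm
  have hm0 : 0 ≤ m := by positivity
  have hi2 : IntegrableOn (xderiv w 2) (Ioo 0 ℓ) := integrableOn_Lp _
  have hi1 : IntegrableOn (xderiv w 1) (Ioo 0 ℓ) := integrableOn_Lp _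
  have hP : ∀ x ∈ Icc 0 ℓ, |∫ s in (0 : ℝ)..x, (xderiv w 2) s| ≤ m := by
    intro x hx
    have := integral_norm_Lp_le hℓ.le (xderiv w 2)
    rw [sub_zero] at this
    exact (abs_primitive_le hi2 hx).trans this
  have hCm : |C| ≤ m := by
    have e : ∫ s in (0 : ℝ)..ℓ, (xderiv w 1) s
        = ∫ s in (0 : ℝ)..ℓ, (C + ∫ r in (0 : ℝ)..s, (xderiv w 2) r) :=
      intervalIntegral_congr_ae_Ioo h1 (left_mem_Icc.2 hℓ.le) (right_mem_Icc.2 hℓ.le)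
    have hPc : ContinuousOn (fun s => ∫ r in (0 : ℝ)..s, (xderiv w 2) r) (Icc 0 ℓ) :=
      continuousOn_primitive_Ioo hℓ.le hi2
    rw [hz, intervalIntegral.integral_add (by simp)
      (hPc.intervalIntegrable_of_Icc hℓ.le)] at e
    simp only [intervalIntegral.integral_const, sub_zero, smul_eq_mul] at e
    have h2 : |∫ s in (0 : ℝ)..ℓ, ∫ r in (0 : ℝ)..s, (xderiv w 2) r| ≤ m * |ℓ - 0| := by
      rw [← Real.norm_eq_abs (∫ s in (0 : ℝ)..ℓ, ∫ r in (0 : ℝ)..s, (xderiv w 2) r)]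
      refine intervalIntegral.norm_integral_le_of_norm_le_const fun x hx => ?_
      rw [uIoc_of_le hℓ.le] at hx
      exact hP x (Ioc_subset_Icc_self hx)
    rw [sub_zero, abs_of_pos hℓ] at h2
    have h3 : ℓ * C = -∫ s in (0 : ℝ)..ℓ, ∫ r in (0 : ℝ)..s, (xderiv w 2) r := by linarith
    have h4 : ℓ * |C| ≤ m * ℓ := by
      rw [← abs_of_pos hℓ, ← abs_mul, abs_of_pos hℓ, h3, abs_neg]; exact h2
    nlinarith
  have hB1 : ∀ᵐ x ∂volume.restrict (Ioo 0 ℓ), ‖(xderiv w 1) x‖ ≤ 2 * m := by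
    filter_upwards [h1, ae_restrict_mem measurableSet_Ioo] with x hx hmem
    rw [hx]
    have := hP x (Ioo_subset_Icc_self hmem)
    exact (norm_add_le _ _).trans (by rw [Real.norm_eq_abs, Real.norm_eq_abs]; linarith)
  have hB0 : ∀ᵐ x ∂volume.restrict (Ioo 0 ℓ), ‖(xderiv w 0) x‖ ≤ 2 * m * ℓ := by
    filter_upwards [h0, ae_restrict_mem measurableSet_Ioo] with x hx hmem
    rw [hx]
    refine (abs_primitive_le hi1 (Ioo_subset_Icc_self hmem)).trans ?_
    have := norm_setIntegral_le_of_norm_le_const_ae' (μ := volume) (s := Ioo 0 ℓ)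
      (f := fun s => ‖(xderiv w 1) s‖) (C := 2 * m) (by simp) ?_
    · simp [hℓ.le] at this
      exact (le_abs_self _).trans this
    · rw [ae_restrict_iff' measurableSet_Ioo] at hB1
      filter_upwards [hB1] with s hs hs'
      rw [norm_norm]
      exact hs hs'
  have hB0' := Lp_norm_le_of_ae_bound hℓ.le (by positivity) hB0
  have hB1' := Lp_norm_le_of_ae_bound hℓ.le (by positivity) hB1
  rw [sub_zero] at hB0' hB1'
  have key : ∀ (j : ℕ) (hj : j ≤ 2),
      ‖xderiv w j hj‖ ≤ (1 + 2 * √ℓ * √ℓ * (1 + ℓ)) * ‖xderiv w 2‖ := by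
    have hs := Real.sqrt_nonneg ℓ
    have hn := norm_nonneg (xderiv w 2)
    have e1 : √ℓ * (2 * m) = (2 * √ℓ * √ℓ) * ‖xderiv w 2‖ := by rw [hm]; ring
    have e2 : √ℓ * (2 * m * ℓ) = (2 * √ℓ * √ℓ) * ‖xderiv w 2‖ * ℓ := by rw [hm]; ring
    have h3 : 0 ≤ (2 * √ℓ * √ℓ) * ‖xderiv w 2‖ := by positivity
    have h4 : 0 ≤ (2 * √ℓ * √ℓ) * ‖xderiv w 2‖ * ℓ := by positivity
    have e3 : (1 + 2 * √ℓ * √ℓ * (1 + ℓ)) * ‖xderiv w 2‖ = ‖xderiv w 2‖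
      + (2 * √ℓ * √ℓ) * ‖xderiv w 2‖ + (2 * √ℓ * √ℓ) * ‖xderiv w 2‖ * ℓ := by ring
    intro j hj
    interval_cases j
    · rw [e3]; rw [e2] at hB0'; linarith
    · rw [e3]; rw [e1] at hB1'; linarith
    · rw [e3]; linarith
  have := SobolevH.norm_le w.1
    (C := (1 + 2 * √ℓ * √ℓ * (1 + ℓ)) * ‖xderiv w 2‖) (by positivity) key
  norm_num at this ⊢
  exact this

theorem exists_xderiv_two_eq (hℓ : 0 < ℓ) (g : Lp ℝ 2 (volume.restrict (Ioo 0 ℓ))) :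
    ∃ w : H01H2 ℓ, xderiv w 2 = g := by
  have hgi : IntegrableOn g (Ioo 0 ℓ) := integrableOn_Lp g
  -- The slope at `0` for which the double primitive `w₀` of `g` also vanishes at `ℓ`.
  set C : ℝ := -(ℓ⁻¹ * ∫ s in (0 : ℝ)..ℓ, ∫ r in (0 : ℝ)..s, g r) with hC
  set w₁ : ℝ → ℝ := fun x => C + ∫ s in (0 : ℝ)..x, g s with hw₁
  set w₀ : ℝ → ℝ := fun x => ∫ s in (0 : ℝ)..x, w₁ s with hw₀
  have hPc : ContinuousOn (fun s => ∫ r in (0 : ℝ)..s, g r) (Icc 0 ℓ) :=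
    continuousOn_primitive_Ioo hℓ.le hgi
  have hw₁c : ContinuousOn w₁ (Icc 0 ℓ) := continuousOn_const.add hPc
  have hw₁i : IntegrableOn w₁ (Ioo 0 ℓ) := hw₁c.integrableOn_Icc.mono_set Ioo_subset_Icc_self
  have hw₀c : ContinuousOn w₀ (Icc 0 ℓ) := continuousOn_primitive_Ioo hℓ.le hw₁i
  have hm₁ := memLp_two_of_continuousOn hw₁c
  have hm₀ := memLp_two_of_continuousOn hw₀c
  have hwℓ : w₀ ℓ = 0 := by
    simp only [hw₀, hw₁]
    rw [intervalIntegral.integral_add (by simp) (hPc.intervalIntegrable_of_Icc hℓ.le)]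
    simp only [intervalIntegral.integral_const, sub_zero, smul_eq_mul, hC]
    field_simp
    ring
  have hd₁ : HasWeakDeriv 0 ℓ hm₁.toLp g :=
    hasWeakDeriv_of_ae_eq_primitive C hgi (by filter_upwards [hm₁.coeFn_toLp] with x hx using hx)
  have hd₀ : HasWeakDeriv 0 ℓ hm₀.toLp hm₁.toLp := by
    refine HasWeakDeriv.congr (u := w₀) (g := w₁) ?_ hm₀.coeFn_toLp.symm hm₁.coeFn_toLp.symm
    exact hasWeakDeriv_of_ae_eq_primitive 0 hw₁i (Filter.Eventually.of_forall fun x => by simp [hw₀])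
  let u : SobolevH ℝ 2 0 ℓ := SobolevH.mk ![hm₀.toLp, hm₁.toLp, g] (by
    intro j
    fin_cases j
    · exact hd₀
    · exact hd₁)
  exact ⟨⟨u, ⟨w₀, hw₀c, hm₀.coeFn_toLp.symm, by simp [hw₀]⟩,
    ⟨w₀, hw₀c, hm₀.coeFn_toLp.symm, hwℓ⟩⟩, rfl⟩

theorem bijective_xderiv_two (hℓ : 0 < ℓ) : Function.Bijective
    (xderivCLM ℓ 2 : H01H2 ℓ →ₗ[ℝ] Lp ℝ 2 (volume.restrict (Ioo 0 ℓ))) := by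
  refine ⟨?_, exists_xderiv_two_eq hℓ⟩
  rw [injective_iff_map_eq_zero]
  intro w hw
  have h := H01H2.norm_le hℓ w
  have hw' : xderiv w 2 = 0 := hw
  rw [hw', norm_zero, mul_zero, mul_zero] at h
  exact norm_le_zero_iff.1 h

/-- The second derivative as an isomorphism of `H^1_0 ∩ H^2` onto `L²`. -/
def xderivTwoEquiv (hℓ : 0 < ℓ) : H01H2 ℓ ≃L[ℝ] Lp ℝ 2 (volume.restrict (Ioo 0 ℓ)) :=
  (LinearEquiv.ofBijective _ (bijective_xderiv_two hℓ)).toContinuousLinearEquivOfBounds 1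
    (3 * (1 + 2 * √ℓ * √ℓ * (1 + ℓ)))
    (fun w => by rw [one_mul]; exact norm_wderiv_le w.1 2 le_rfl)
    (fun g => by
      obtain ⟨w, rfl⟩ := exists_xderiv_two_eq hℓ g
      have e : (LinearEquiv.ofBijective _ (bijective_xderiv_two hℓ)).symm (xderiv w 2) = w :=
        (LinearEquiv.symm_apply_eq _).2 rfl
      rw [e, mul_assoc]
      exact H01H2.norm_le hℓ w)

/-- Completeness is inherited from `L²` through the isomorphism `w ↦ w''`, so no closedness of the
boundary conditions has to be checked. -/
theorem completeSpace_H01H2 (hℓ : 0 < ℓ) : CompleteSpace (H01H2 ℓ) :=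
  (completeSpace_congr (e := (xderivTwoEquiv hℓ).toEquiv)
    (xderivTwoEquiv hℓ).isUniformEmbedding).2 inferInstance

/-- Integration by parts gives `∫ w w'' = -∫ (w')²`; both the boundary term and the contribution of
`C` vanish because `w'` has mean zero. -/
theorem inner_xderiv_zero_two_nonpos (hℓ : 0 < ℓ) (w : H01H2 ℓ) :
    inner ℝ (xderiv w 0) (xderiv w 2) ≤ 0 := by
  obtain ⟨C, h0, h1, hz⟩ := H01H2.ae_eq_primitive hℓ w
  have hi2 : IntegrableOn (xderiv w 2) (Ioo 0 ℓ) := integrableOn_Lp _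
  have hi1 : IntegrableOn (xderiv w 1) (Ioo 0 ℓ) := integrableOn_Lp _
  have key := integral_primitive_smul_add hi1 hi2
  rw [← intervalIntegral_eq_setIntegral_Ioo hℓ.le (xderiv w 1), hz, zero_smul] at key
  have e0 : inner ℝ (xderiv w 0) (xderiv w 2)
      = ∫ t in Ioo 0 ℓ, (∫ s in (0 : ℝ)..t, (xderiv w 1) s) • (xderiv w 2) t := by
    rw [L2.inner_def]
    refine integral_congr_ae ?_
    filter_upwards [h0] with x hx
    rw [hx, real_inner_comm]
    simp
  have e1 : ∫ t in Ioo 0 ℓ, (xderiv w 1) t • ∫ s in (0 : ℝ)..t, (xderiv w 2) s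
      = ∫ t in Ioo 0 ℓ, ((xderiv w 1) t * (xderiv w 1) t - (xderiv w 1) t * C) := by
    refine integral_congr_ae ?_
    filter_upwards [h1] with x hx
    simp only [smul_eq_mul]
    rw [← mul_sub]
    congr 1
    linarith
  have hsq : IntegrableOn (fun t => (xderiv w 1) t * (xderiv w 1) t) (Ioo 0 ℓ) := by
    have := (Lp.memLp (xderiv w 1)).integrable_sq
    simpa only [IntegrableOn, sq] using this
  rw [integral_sub hsq (hi1.mul_const C), integral_mul_const,
    ← intervalIntegral_eq_setIntegral_Ioo hℓ.le (xderiv w 1), hz, zero_mul, sub_zero] at e1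
  have hnn : 0 ≤ ∫ t in Ioo 0 ℓ, (xderiv w 1) t * (xderiv w 1) t :=
    integral_nonneg fun t => mul_self_nonneg _
  rw [e0]
  linarith

/-- The operator `1 - β d²/dx²` with Dirichlet boundary conditions. -/
def helmholtz (ℓ β : ℝ) : H01H2 ℓ →L[ℝ] Lp ℝ 2 (volume.restrict (Ioo 0 ℓ)) :=
  xderivCLM ℓ 0 - β • xderivCLM ℓ 2

theorem helmholtz_apply (β : ℝ) (w : H01H2 ℓ) :
    helmholtz ℓ β w = xderiv w 0 - β • xderiv w 2 := rfl

/-- The bilinear form of `β d²/dx² - 1` in terms of the second derivatives. -/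
def helmholtzForm (hℓ : 0 < ℓ) (β : ℝ) : Lp ℝ 2 (volume.restrict (Ioo 0 ℓ)) →L[ℝ]
    Lp ℝ 2 (volume.restrict (Ioo 0 ℓ)) →L[ℝ] ℝ :=
  -((innerSL ℝ).comp ((helmholtz ℓ β).comp
    ((xderivTwoEquiv hℓ).symm : Lp ℝ 2 (volume.restrict (Ioo 0 ℓ)) →L[ℝ] H01H2 ℓ)))

theorem helmholtzForm_apply (hℓ : 0 < ℓ) (β : ℝ) (w : H01H2 ℓ)
    (g : Lp ℝ 2 (volume.restrict (Ioo 0 ℓ))) :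
    helmholtzForm hℓ β (xderiv w 2) g = -inner ℝ (helmholtz ℓ β w) g := by
  have e : (xderivTwoEquiv hℓ).symm (xderiv w 2) = w :=
    (xderivTwoEquiv hℓ).symm_apply_eq.2 rfl
  simp [helmholtzForm, e]

/-- Testing with `g = w''` gives `-⟨w - β w'', w''⟩ = β ‖w''‖² - ⟨w, w''⟩ ≥ β ‖w''‖²`. Parametrising
`X` by `w''` lets the Lax–Milgram theorem be applied in the Hilbert space `L²`. -/
theorem isCoercive_helmholtzForm (hℓ : 0 < ℓ) {β : ℝ} (hβ : 0 < β) :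
    IsCoercive (helmholtzForm hℓ β) := by
  refine ⟨β, hβ, fun g => ?_⟩
  obtain ⟨w, rfl⟩ := exists_xderiv_two_eq hℓ g
  rw [helmholtzForm_apply, helmholtz_apply, inner_sub_left, real_inner_smul_left,
    real_inner_self_eq_norm_mul_norm]
  have := inner_xderiv_zero_two_nonpos hℓ w
  linarith

/-- The inverse of `1 - β d²/dx²` with Dirichlet boundary conditions. -/
def helmholtzInv (hℓ : 0 < ℓ) {β : ℝ} (hβ : 0 < β) :
    Lp ℝ 2 (volume.restrict (Ioo 0 ℓ)) →L[ℝ] H01H2 ℓ :=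
  -((xderivTwoEquiv hℓ).symm : Lp ℝ 2 (volume.restrict (Ioo 0 ℓ)) →L[ℝ] H01H2 ℓ).comp
    ((isCoercive_helmholtzForm hℓ hβ).continuousLinearEquivOfBilin.symm :
      Lp ℝ 2 (volume.restrict (Ioo 0 ℓ)) →L[ℝ] Lp ℝ 2 (volume.restrict (Ioo 0 ℓ)))

/-- Identifies the Lax–Milgram operator as `w'' ↦ -(w - β w'')`; this sign is the one compensated in
`helmholtzInv`. -/
theorem continuousLinearEquivOfBilin_helmholtzForm (hℓ : 0 < ℓ) {β : ℝ} (hβ : 0 < β)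
    (w : H01H2 ℓ) : (isCoercive_helmholtzForm hℓ hβ).continuousLinearEquivOfBilin (xderiv w 2)
      = -helmholtz ℓ β w := by
  refine ((isCoercive_helmholtzForm hℓ hβ).unique_continuousLinearEquivOfBilin fun g => ?_).symm
  rw [helmholtzForm_apply, inner_neg_left]

theorem helmholtzInv_helmholtz (hℓ : 0 < ℓ) {β : ℝ} (hβ : 0 < β) (w : H01H2 ℓ) :
    helmholtzInv hℓ hβ (helmholtz ℓ β w) = w := by
  have h := continuousLinearEquivOfBilin_helmholtzForm hℓ hβ w
  have h' : (isCoercive_helmholtzForm hℓ hβ).continuousLinearEquivOfBilin.symm (helmholtz ℓ β w)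
      = -xderiv w 2 := by
    rw [ContinuousLinearEquiv.symm_apply_eq, map_neg, h, neg_neg]
  have e : (xderivTwoEquiv hℓ).symm (xderiv w 2) = w :=
    (xderivTwoEquiv hℓ).symm_apply_eq.2 rfl
  simp [helmholtzInv, h', e]

theorem helmholtz_helmholtzInv (hℓ : 0 < ℓ) {β : ℝ} (hβ : 0 < β)
    (g : Lp ℝ 2 (volume.restrict (Ioo 0 ℓ))) : helmholtz ℓ β (helmholtzInv hℓ hβ g) = g := by
  set g' := (isCoercive_helmholtzForm hℓ hβ).continuousLinearEquivOfBilin.symm g with hg'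
  obtain ⟨w, hw⟩ := exists_xderiv_two_eq hℓ g'
  have h := continuousLinearEquivOfBilin_helmholtzForm hℓ hβ w
  rw [hw, hg', ContinuousLinearEquiv.apply_symm_apply] at h
  have e : (xderivTwoEquiv hℓ).symm g' = w := (xderivTwoEquiv hℓ).symm_apply_eq.2 hw.symm
  have e' : helmholtzInv hℓ hβ g = -w := by
    simp [helmholtzInv, ← hg', e]
  rw [e', map_neg, ← h]

theorem eq_helmholtzInv_iff (hℓ : 0 < ℓ) {β : ℝ} (hβ : 0 < β) (w : H01H2 ℓ)
    (g : Lp ℝ 2 (volume.restrict (Ioo 0 ℓ))) :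
    w = helmholtzInv hℓ hβ g ↔ helmholtz ℓ β w = g :=
  ⟨fun h => by rw [h, helmholtz_helmholtzInv], fun h => by rw [← h, helmholtzInv_helmholtz]⟩

end SpaceX

/-- An integrable function that is bounded by a multiple of its primitive vanishes. -/
theorem ae_eq_zero_of_le_mul_primitive {τ K : ℝ} (hτ : 0 ≤ τ) {d : ℝ → ℝ}
    (hd : IntegrableOn d (Ioo 0 τ)) (h0 : ∀ t, 0 ≤ d t) (hK : 0 ≤ K)
    (h : ∀ᵐ t ∂volume.restrict (Ioo 0 τ), d t ≤ K * ∫ s in (0 : ℝ)..t, d s) :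
    ∀ᵐ t ∂volume.restrict (Ioo 0 τ), d t = 0 := by
  set e : ℝ → ℝ := (Ioo 0 τ).indicator d with he
  have hei : Integrable e := hd.integrable_indicator measurableSet_Ioo
  set D : ℝ → ℝ := fun t => ∫ s in (0 : ℝ)..t, e s with hD
  have hDc : Continuous D := intervalIntegral.continuous_primitive
    (fun a b => hei.intervalIntegrable) 0
  -- `d` is merely integrable, so the inequality is integrated once: `D ≤ K F` with `F' = D`
  -- continuous. Grönwall's inequality for `F` gives `F = 0`, then `D ≤ 0`, then `d ≤ 0`. The
  -- extension `e` by zero makes `D` and `F` regular on the whole line.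
  set F : ℝ → ℝ := fun t => ∫ s in (0 : ℝ)..t, D s with hF
  have hFd : ∀ t, HasDerivAt F (D t) t := fun t =>
    intervalIntegral.integral_hasDerivAt_right (hDc.intervalIntegrable _ _)
      (hDc.stronglyMeasurableAtFilter _ _) hDc.continuousAt
  have hed : e =ᵐ[volume.restrict (Ioo 0 τ)] d := by
    filter_upwards [ae_restrict_mem measurableSet_Ioo] with t ht
    simp [he, ht]
  have hDd : ∀ t ∈ Icc 0 τ, D t = ∫ s in (0 : ℝ)..t, d s := fun t ht =>
    intervalIntegral_congr_ae_Ioo hed (left_mem_Icc.2 hτ) ht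
  have hDK : ∀ t ∈ Icc 0 τ, D t ≤ K * F t := by
    intro t ht
    rw [hDd t ht, hF]
    simp only
    rw [← intervalIntegral.integral_const_mul]
    refine intervalIntegral.integral_mono_ae_restrict ht.1
      (intervalIntegrable_of_Ioo hd (left_mem_Icc.2 hτ) ht)
      ((continuous_const.mul hDc).intervalIntegrable _ _) ?_
    have hsub : Icc 0 t ⊆ Icc 0 τ := Icc_subset_Icc_right ht.2
    have h' : ∀ᵐ t ∂volume.restrict (Icc 0 τ), d t ≤ K * ∫ s in (0 : ℝ)..t, d s := by
      rwa [Measure.restrict_congr_set Ioo_ae_eq_Icc] at h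
    filter_upwards [ae_restrict_of_ae_restrict_of_subset hsub h',
      ae_restrict_mem measurableSet_Icc] with s hs hmem
    rw [hDd s (hsub hmem)]
    exact hs
  have hDnn : ∀ t ∈ Icc 0 τ, 0 ≤ D t := fun t ht =>
    intervalIntegral.integral_nonneg ht.1 fun s _ => indicator_nonneg (fun _ _ => h0 _) _
  have hF0 : ∀ t ∈ Icc 0 τ, F t = 0 := by
    refine eq_zero_of_abs_deriv_le_mul_abs_self_of_eq_zero_right (f' := D) (K := K)
      (fun t _ => (hFd t).continuousAt.continuousWithinAt)
      (fun t _ => (hFd t).hasDerivWithinAt) (by simp [hF]) fun t ht => ?_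
    have ht' := Ico_subset_Icc_self ht
    rw [Real.norm_eq_abs, abs_of_nonneg (hDnn t ht')]
    exact (hDK t ht').trans (mul_le_mul_of_nonneg_left (le_abs_self _) hK)
  filter_upwards [h, ae_restrict_mem measurableSet_Ioo] with t ht hmem
  have hmem' := Ioo_subset_Icc_self hmem
  have h1 := hDK t hmem'
  rw [hF0 t hmem', mul_zero, hDd t hmem'] at h1
  have h2 := h0 t
  nlinarith

/-! ### Convolutions on a finite interval -/

section Conv

variable {Y : Type*} [NormedAddCommGroup Y] [NormedSpace ℝ Y] {τ : ℝ}

/-- The convolution `∫_0^t a(t - s) g(s) ds`. -/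
def conv (a : ℝ → ℝ) (g : ℝ → Y) (t : ℝ) : Y := ∫ s in (0 : ℝ)..t, a (t - s) • g s

theorem intervalIntegrable_reflect {a : ℝ → ℝ} (ha : IntegrableOn a (Ioo 0 τ)) {t : ℝ}
    (ht : t ∈ Icc 0 τ) : IntervalIntegrable (fun s => a (t - s)) volume 0 t := by
  have := (intervalIntegrable_of_Ioo ha (left_mem_Icc.2 (ht.1.trans ht.2)) ht).comp_sub_left t
  rw [sub_zero, sub_self] at this
  exact this.symm

theorem intervalIntegrable_conv {a : ℝ → ℝ} {g : ℝ → Y} (ha : IntegrableOn a (Ioo 0 τ))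
    (hg : ContinuousOn g (Icc 0 τ)) {t : ℝ} (ht : t ∈ Icc 0 τ) :
    IntervalIntegrable (fun s => a (t - s) • g s) volume 0 t := by
  refine (intervalIntegrable_reflect ha ht).smul_continuousOn (hg.mono ?_)
  rw [uIcc_of_le ht.1]
  exact Icc_subset_Icc_right ht.2

/-- The reflection `s ↦ t - s` preserves null sets. This is why a convolution at a given `t` does
not see the choice of representatives. -/
theorem ae_reflect {p : ℝ → Prop} {t : ℝ} (ht : t ∈ Icc 0 τ)
    (h : ∀ᵐ s ∂volume.restrict (Ioo 0 τ), p s) : ∀ᵐ s, s ∈ Ioc 0 t → p (t - s) := by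
  have h' : ∀ᵐ s ∂volume.restrict (Icc 0 τ), p s := by
    rwa [Measure.restrict_congr_set Ioo_ae_eq_Icc] at h
  rw [ae_restrict_iff' measurableSet_Icc] at h'
  have := (Measure.measurePreserving_sub_left volume t).quasiMeasurePreserving.ae h'
  filter_upwards [this] with s hs hmem
  exact hs ⟨by linarith [hmem.2], by linarith [hmem.1, ht.2]⟩

theorem conv_congr_ae {a a' : ℝ → ℝ} {g g' : ℝ → Y} {t : ℝ} (ht : t ∈ Icc 0 τ)
    (ha : a =ᵐ[volume.restrict (Ioo 0 τ)] a') (hg : g =ᵐ[volume.restrict (Ioo 0 τ)] g') :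
    conv a g t = conv a' g' t := by
  refine intervalIntegral.integral_congr_ae ?_
  have h1 := ae_reflect ht ha
  have hg' : g =ᵐ[volume.restrict (Icc 0 τ)] g' := by
    rwa [Measure.restrict_congr_set Ioo_ae_eq_Icc] at hg
  rw [Filter.EventuallyEq, ae_restrict_iff' measurableSet_Icc] at hg'
  rw [uIoc_of_le ht.1]
  filter_upwards [h1, hg'] with s hs hs' hmem
  rw [hs hmem, hs' ⟨hmem.1.le, hmem.2.trans ht.2⟩]

theorem map_conv {Z : Type*} [NormedAddCommGroup Z] [NormedSpace ℝ Z]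
    [CompleteSpace Y] [CompleteSpace Z] (L : Y →L[ℝ] Z) {a : ℝ → ℝ} {g : ℝ → Y}
    (ha : IntegrableOn a (Ioo 0 τ)) (hg : ContinuousOn g (Icc 0 τ)) {t : ℝ} (ht : t ∈ Icc 0 τ) :
    L (conv a g t) = conv a (fun s => L (g s)) t := by
  rw [conv, ← L.intervalIntegral_comp_comm (intervalIntegrable_conv ha hg ht)]
  simp only [map_smul]
  rfl

/-- Uses `a * g - a' * g' = (a - a') * g + a' * (g - g')`. The kernels are measured in `L¹`, since
`k'` is not known to be bounded, and the other factors in the supremum norm. -/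
theorem norm_conv_sub_le {a a' : ℝ → ℝ} {g g' : ℝ → Y} {G δ t : ℝ}
    (ha : IntegrableOn a (Ioo 0 τ)) (ha' : IntegrableOn a' (Ioo 0 τ))
    (hg : ContinuousOn g (Icc 0 τ)) (hg' : ContinuousOn g' (Icc 0 τ)) (ht : t ∈ Icc 0 τ)
    (hG : ∀ s ∈ Icc 0 t, ‖g s‖ ≤ G) (hδ : ∀ s ∈ Icc 0 t, ‖g s - g' s‖ ≤ δ) :
    ‖conv a g t - conv a' g' t‖
      ≤ G * (∫ s in (0 : ℝ)..t, |a s - a' s|) + δ * ∫ s in (0 : ℝ)..t, |a' s| := by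
  have hi := intervalIntegrable_of_Ioo ha (left_mem_Icc.2 (ht.1.trans ht.2)) ht
  have hi' := intervalIntegrable_of_Ioo ha' (left_mem_Icc.2 (ht.1.trans ht.2)) ht
  have hb1 : IntervalIntegrable (fun s => |a (t - s) - a' (t - s)|) volume 0 t :=
    (intervalIntegrable_reflect ha ht).sub (intervalIntegrable_reflect ha' ht) |>.abs
  have hb2 : IntervalIntegrable (fun s => |a' (t - s)|) volume 0 t :=
    (intervalIntegrable_reflect ha' ht).abs
  have e1 : ∫ s in (0 : ℝ)..t, |a (t - s) - a' (t - s)| = ∫ s in (0 : ℝ)..t, |a s - a' s| := by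
    rw [intervalIntegral.integral_comp_sub_left (fun s => |a s - a' s|), sub_self, sub_zero]
  have e2 : ∫ s in (0 : ℝ)..t, |a' (t - s)| = ∫ s in (0 : ℝ)..t, |a' s| := by
    rw [intervalIntegral.integral_comp_sub_left (fun s => |a' s|), sub_self, sub_zero]
  rw [conv, conv, ← intervalIntegral.integral_sub (intervalIntegrable_conv ha hg ht)
    (intervalIntegrable_conv ha' hg' ht), ← e1, ← e2, ← intervalIntegral.integral_const_mul,
    ← intervalIntegral.integral_const_mul,
    ← intervalIntegral.integral_add (hb1.const_mul G) (hb2.const_mul δ)]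
  refine intervalIntegral.norm_integral_le_of_norm_le ht.1 (Filter.Eventually.of_forall
    fun s hs => ?_) ((hb1.const_mul G).add (hb2.const_mul δ))
  have hs' := Ioc_subset_Icc_self hs
  have e : a (t - s) • g s - a' (t - s) • g' s
      = (a (t - s) - a' (t - s)) • g s + a' (t - s) • (g s - g' s) := by
    rw [sub_smul, smul_sub]; abel
  rw [e]
  refine (norm_add_le _ _).trans ?_
  rw [norm_smul, norm_smul, Real.norm_eq_abs, Real.norm_eq_abs, mul_comm G, mul_comm δ]
  exact add_le_add (mul_le_mul_of_nonneg_left (hG s hs') (abs_nonneg _))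
    (mul_le_mul_of_nonneg_left (hδ s hs') (abs_nonneg _))

theorem continuousOn_conv [CompleteSpace Y] (hτ : 0 ≤ τ) {a : ℝ → ℝ} {g : ℝ → Y}
    (ha : IntegrableOn a (Ioo 0 τ)) (hg : ContinuousOn g (Icc 0 τ)) :
    ContinuousOn (conv a g) (Icc 0 τ) := by
  obtain ⟨C, hC⟩ := isCompact_Icc.exists_bound_of_continuousOn hg
  -- Subtracting `g 0` makes the extension by zero to negative arguments continuous. The part `∫₀ᵗ
  -- a(s) G(t - s) ds` can then be taken over the fixed interval `(0, τ)`, where dominated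
  -- convergence applies.
  set G : ℝ → Y := fun r => IccExtend hτ ((Icc 0 τ).domRestrict g) r - g 0 with hG
  have hGc : Continuous G :=
    (continuous_IccExtend_iff.2 hg.domRestrict).sub continuous_const
  have hGb : ∀ r, ‖G r‖ ≤ C + C := fun r =>
    (norm_sub_le _ _).trans (add_le_add (hC _ (projIcc 0 τ hτ r).2) (hC _ (left_mem_Icc.2 hτ)))
  have hGneg : ∀ r ≤ 0, G r = 0 := fun r hr => by
    simp [hG, IccExtend_of_le_left _ _ hr]
  have hGpos : ∀ r ∈ Icc 0 τ, G r = g r - g 0 := fun r hr => by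
    simp [hG, IccExtend_of_mem _ _ hr]
  have hcont : Continuous fun t => ∫ s in (0 : ℝ)..τ, a s • G (t - s) := by
    have hai := intervalIntegrable_of_Ioo ha (left_mem_Icc.2 hτ) (right_mem_Icc.2 hτ)
    refine intervalIntegral.continuous_of_dominated_interval (bound := fun s => |a s| * (C + C))
      (fun t => ?_) (fun t => ?_) (hai.abs.mul_const _) ?_
    · have := (hai.smul_continuousOn (g := fun s => G (t - s))
        (hGc.comp (continuous_const.sub continuous_id)).continuousOn).aestronglyMeasurable_restrict_uIoc
      exact this
    · refine Filter.Eventually.of_forall fun s _ => ?_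
      rw [norm_smul, Real.norm_eq_abs]
      exact mul_le_mul_of_nonneg_left (hGb _) (abs_nonneg _)
    · refine Filter.Eventually.of_forall fun s _ => ?_
      exact continuous_const.smul (hGc.comp (continuous_id.sub continuous_const))
  have heq : EqOn (conv a g)
      (fun t => (∫ s in (0 : ℝ)..t, a s) • g 0 + ∫ s in (0 : ℝ)..τ, a s • G (t - s))
      (Icc 0 τ) := by
    intro t ht
    have hat := intervalIntegrable_of_Ioo ha (left_mem_Icc.2 hτ) ht
    have haτ := intervalIntegrable_of_Ioo ha ht (right_mem_Icc.2 hτ)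
    have hGt : Continuous fun s => G (t - s) := hGc.comp (continuous_const.sub continuous_id)
    have h1 : conv a g t = ∫ s in (0 : ℝ)..t, a s • g (t - s) := by
      have := intervalIntegral.integral_comp_sub_left (a := 0) (b := t)
        (fun s => a s • g (t - s)) t
      rw [sub_self, sub_zero] at this
      rw [← this, conv]
      simp only [sub_sub_cancel]
    have h2 : ∫ s in t..τ, a s • G (t - s) = 0 := by
      rw [intervalIntegral.integral_congr (g := fun _ => (0 : Y))]
      · simp
      · intro s hs
        rw [uIcc_of_le ht.2] at hs
        simp [hGneg (t - s) (by linarith [hs.1])]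
    simp only
    rw [h1, ← intervalIntegral.integral_add_adjacent_intervals
      (hat.smul_continuousOn hGt.continuousOn) (haτ.smul_continuousOn hGt.continuousOn), h2,
      add_zero, ← intervalIntegral.integral_smul_const, ← intervalIntegral.integral_add
        (hat.smul_continuousOn continuousOn_const) (hat.smul_continuousOn hGt.continuousOn)]
    refine intervalIntegral.integral_congr fun s hs => ?_
    rw [uIcc_of_le ht.1] at hs
    rw [hGpos (t - s) ⟨by linarith [hs.2], by linarith [hs.1, ht.2]⟩, ← smul_add,
      add_sub_cancel]
  refine ContinuousOn.congr ?_ heq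
  exact ((continuousOn_primitive_Ioo hτ ha).smul continuousOn_const).add hcont.continuousOn

end Conv

/-- The coefficients of a nonlinear Volterra equation
`z = c + P U + κ(z) * M U + κ'(U) * M' U` with `U = U₀ + ∫_0^t z`. -/
structure VolterraData (Y : Type*) [NormedAddCommGroup Y] [NormedSpace ℝ Y] where
  U₀ : Y
  P : Y →L[ℝ] Y
  κ : Y →L[ℝ] ℝ
  κ' : Y →L[ℝ] ℝ
  M : Y →L[ℝ] Y
  M' : Y →L[ℝ] Y

/-! ### The Volterra equation: Lipschitz estimate, local existence, uniqueness -/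

namespace VolterraData

variable {Y : Type*} [NormedAddCommGroup Y] [NormedSpace ℝ Y] (V : VolterraData Y)

/-- The primitive `U₀ + ∫_0^t z`. -/
def prim (z : ℝ → Y) (t : ℝ) : Y := V.U₀ + ∫ s in (0 : ℝ)..t, z s

/-- The right-hand side of the Volterra equation without the forcing term. -/
def op (z : ℝ → Y) (t : ℝ) : Y :=
  V.P (V.prim z t) + conv (fun s => V.κ (z s)) (fun s => V.M (V.prim z s)) t
    + conv (fun s => V.κ' (V.prim z s)) (fun s => V.M' (V.prim z s)) t

/-- The Lipschitz constant of `op` on functions of `L¹`-norm at most `N`. -/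
def lip (N : ℝ) : ℝ :=
  ‖V.P‖ + (‖V.M‖ * (‖V.U₀‖ + N) * ‖V.κ‖ + ‖V.M‖ * (‖V.κ‖ * N))
    + (‖V.M'‖ * (‖V.U₀‖ + N) * ‖V.κ'‖ + ‖V.M'‖ * (‖V.κ'‖ * (‖V.U₀‖ + N)))

theorem lip_nonneg {N : ℝ} (hN : 0 ≤ N) : 0 ≤ V.lip N := by
  unfold lip; positivity

variable {τ : ℝ}

theorem continuousOn_prim (hτ : 0 ≤ τ) {z : ℝ → Y} (hz : IntegrableOn z (Ioo 0 τ)) :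
    ContinuousOn (V.prim z) (Icc 0 τ) :=
  continuousOn_const.add (continuousOn_primitive_Ioo hτ hz)

theorem norm_primitive_le {z : ℝ → Y} (hz : IntegrableOn z (Ioo 0 τ)) {t : ℝ}
    (ht : t ∈ Icc 0 τ) : ‖∫ s in (0 : ℝ)..t, z s‖ ≤ ∫ s in Ioo 0 τ, ‖z s‖ := by
  rw [intervalIntegral_eq_setIntegral_Ioo ht.1]
  refine (norm_integral_le_integral_norm _).trans ?_
  exact setIntegral_mono_set hz.norm (Filter.Eventually.of_forall fun _ => norm_nonneg _)
    (Ioo_subset_Ioo_right ht.2).eventuallyLE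

theorem norm_prim_le {z : ℝ → Y} (hz : IntegrableOn z (Ioo 0 τ)) {N t : ℝ}
    (hN : ∫ s in Ioo 0 τ, ‖z s‖ ≤ N) (ht : t ∈ Icc 0 τ) : ‖V.prim z t‖ ≤ ‖V.U₀‖ + N :=
  (norm_add_le _ _).trans (add_le_add le_rfl ((norm_primitive_le hz ht).trans hN))

theorem norm_prim_sub_le {z z' : ℝ → Y} (hz : IntegrableOn z (Ioo 0 τ))
    (hz' : IntegrableOn z' (Ioo 0 τ)) {s t : ℝ} (ht : t ∈ Icc 0 τ) (hs : s ∈ Icc 0 t) :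
    ‖V.prim z s - V.prim z' s‖ ≤ ∫ r in (0 : ℝ)..t, ‖z r - z' r‖ := by
  have h0 : (0 : ℝ) ∈ Icc 0 τ := left_mem_Icc.2 (ht.1.trans ht.2)
  have hs' : s ∈ Icc 0 τ := ⟨hs.1, hs.2.trans ht.2⟩
  rw [prim, prim, add_sub_add_left_eq_sub, ← intervalIntegral.integral_sub
    (intervalIntegrable_of_Ioo hz h0 hs') (intervalIntegrable_of_Ioo hz' h0 hs'),
    intervalIntegral_eq_setIntegral_Ioo ht.1]
  exact norm_primitive_le ((hz.sub hz').mono_set (Ioo_subset_Ioo_right ht.2)) hs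

theorem integrableOn_clm {Z : Type*} [NormedAddCommGroup Z] [NormedSpace ℝ Z] (L : Y →L[ℝ] Z)
    {z : ℝ → Y} (hz : IntegrableOn z (Ioo 0 τ)) : IntegrableOn (fun s => L (z s)) (Ioo 0 τ) :=
  L.integrable_comp hz

theorem continuousOn_clm_prim {Z : Type*} [NormedAddCommGroup Z] [NormedSpace ℝ Z]
    (L : Y →L[ℝ] Z) (hτ : 0 ≤ τ) {z : ℝ → Y} (hz : IntegrableOn z (Ioo 0 τ)) :
    ContinuousOn (fun s => L (V.prim z s)) (Icc 0 τ) :=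
  L.continuous.comp_continuousOn (V.continuousOn_prim hτ hz)

theorem integrableOn_clm_prim {Z : Type*} [NormedAddCommGroup Z] [NormedSpace ℝ Z]
    (L : Y →L[ℝ] Z) (hτ : 0 ≤ τ) {z : ℝ → Y} (hz : IntegrableOn z (Ioo 0 τ)) :
    IntegrableOn (fun s => L (V.prim z s)) (Ioo 0 τ) :=
  (V.continuousOn_clm_prim L hτ hz).integrableOn_Icc.mono_set Ioo_subset_Icc_self

theorem continuousOn_op [CompleteSpace Y] (hτ : 0 ≤ τ) {z : ℝ → Y}
    (hz : IntegrableOn z (Ioo 0 τ)) : ContinuousOn (V.op z) (Icc 0 τ) :=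
  ((V.continuousOn_clm_prim V.P hτ hz).add (continuousOn_conv hτ (integrableOn_clm V.κ hz)
    (V.continuousOn_clm_prim V.M hτ hz))).add
    (continuousOn_conv hτ (V.integrableOn_clm_prim V.κ' hτ hz)
      (V.continuousOn_clm_prim V.M' hτ hz))

/-- Only the distance of `z` and `z'` on `(0, t)` enters. This causal form serves both the
contraction for small `τ` and the Grönwall argument for uniqueness. -/
theorem norm_op_sub_le {z z' : ℝ → Y} (hτ1 : τ ≤ 1) (hz : IntegrableOn z (Ioo 0 τ))
    (hz' : IntegrableOn z' (Ioo 0 τ)) {N t : ℝ} (hN : ∫ s in Ioo 0 τ, ‖z s‖ ≤ N)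
    (hN' : ∫ s in Ioo 0 τ, ‖z' s‖ ≤ N) (ht : t ∈ Icc 0 τ) :
    ‖V.op z t - V.op z' t‖ ≤ V.lip N * ∫ s in (0 : ℝ)..t, ‖z s - z' s‖ := by
  have hτ : 0 ≤ τ := ht.1.trans ht.2
  have h0 : (0 : ℝ) ∈ Icc 0 τ := left_mem_Icc.2 hτ
  have hN0 : 0 ≤ N := (integral_nonneg fun _ => norm_nonneg _).trans hN
  set Δ := ∫ s in (0 : ℝ)..t, ‖z s - z' s‖ with hΔ
  have hΔ0 : 0 ≤ Δ := intervalIntegral.integral_nonneg ht.1 fun _ _ => norm_nonneg _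
  have hdi : IntervalIntegrable (fun s => ‖z s - z' s‖) volume 0 t :=
    (intervalIntegrable_of_Ioo (hz.sub hz') h0 ht).norm
  have hU : ∀ s ∈ Icc 0 t, ‖V.prim z s - V.prim z' s‖ ≤ Δ := fun s hs =>
    V.norm_prim_sub_le hz hz' ht hs
  have hB : ∀ s ∈ Icc 0 t, ‖V.prim z s‖ ≤ ‖V.U₀‖ + N := fun s hs =>
    V.norm_prim_le hz hN ⟨hs.1, hs.2.trans ht.2⟩
  have hB' : ∀ s ∈ Icc 0 t, ‖V.prim z' s‖ ≤ ‖V.U₀‖ + N := fun s hs =>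
    V.norm_prim_le hz' hN' ⟨hs.1, hs.2.trans ht.2⟩
  -- As `t ≤ τ ≤ 1`, a bound for a kernel also bounds its `L¹`-norm on `(0, t)`.
  have hconst : ∀ (C : ℝ), 0 ≤ C → ∀ a : ℝ → ℝ, (∀ s ∈ Icc 0 t, |a s| ≤ C) →
      ∫ s in (0 : ℝ)..t, |a s| ≤ C := by
    intro C hC a ha
    have h := intervalIntegral.norm_integral_le_of_norm_le_const (a := 0) (b := t) (C := C)
      (f := fun s => |a s|) (fun s hs => by
        rw [uIoc_of_le ht.1] at hs
        rw [Real.norm_eq_abs, abs_abs]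
        exact ha s (Ioc_subset_Icc_self hs))
    rw [sub_zero, abs_of_nonneg ht.1] at h
    refine (le_abs_self _).trans (h.trans ?_)
    nlinarith [ht.1, ht.2]
  have hP : ‖V.P (V.prim z t) - V.P (V.prim z' t)‖ ≤ ‖V.P‖ * Δ := by
    rw [← map_sub]
    exact V.P.le_opNorm_of_le (hU t (right_mem_Icc.2 ht.1))
  have hκ1 : ∫ s in (0 : ℝ)..t, |V.κ (z s) - V.κ (z' s)| ≤ ‖V.κ‖ * Δ := by
    rw [hΔ, ← intervalIntegral.integral_const_mul]
    refine intervalIntegral.integral_mono ht.1 ?_ (hdi.const_mul _) fun s => ?_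
    · exact (intervalIntegrable_of_Ioo ((integrableOn_clm V.κ hz).sub (integrableOn_clm V.κ hz'))
        h0 ht).abs
    · simp only
      rw [← map_sub]
      exact V.κ.le_opNorm _
  have hκ2 : ∫ s in (0 : ℝ)..t, |V.κ (z' s)| ≤ ‖V.κ‖ * N := by
    have : ∫ s in (0 : ℝ)..t, |V.κ (z' s)| ≤ ∫ s in (0 : ℝ)..t, ‖V.κ‖ * ‖z' s‖ :=
      intervalIntegral.integral_mono ht.1
        (intervalIntegrable_of_Ioo (integrableOn_clm V.κ hz') h0 ht).abs
        ((intervalIntegrable_of_Ioo hz' h0 ht).norm.const_mul _) fun s => V.κ.le_opNorm _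
    refine this.trans ?_
    rw [intervalIntegral.integral_const_mul]
    refine mul_le_mul_of_nonneg_left (le_trans ?_ hN') (norm_nonneg _)
    refine (le_abs_self _).trans ?_
    have := norm_primitive_le (z := fun s => ‖z' s‖) hz'.norm ht
    simpa only [norm_norm, Real.norm_eq_abs, abs_norm] using this
  have hκ'1 : ∫ s in (0 : ℝ)..t, |V.κ' (V.prim z s) - V.κ' (V.prim z' s)| ≤ ‖V.κ'‖ * Δ := by
    refine hconst _ (by positivity) _ fun s hs => ?_
    rw [← map_sub]
    exact V.κ'.le_opNorm_of_le (hU s hs)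
  have hκ'2 : ∫ s in (0 : ℝ)..t, |V.κ' (V.prim z' s)| ≤ ‖V.κ'‖ * (‖V.U₀‖ + N) :=
    hconst _ (by positivity) _ fun s hs => V.κ'.le_opNorm_of_le (hB' s hs)
  have hc1 := norm_conv_sub_le (G := ‖V.M‖ * (‖V.U₀‖ + N)) (δ := ‖V.M‖ * Δ)
    (integrableOn_clm V.κ hz) (integrableOn_clm V.κ hz')
    (V.continuousOn_clm_prim V.M hτ hz) (V.continuousOn_clm_prim V.M hτ hz') ht
    (fun s hs => V.M.le_opNorm_of_le (hB s hs))
    (fun s hs => by rw [← map_sub]; exact V.M.le_opNorm_of_le (hU s hs))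
  have hc2 := norm_conv_sub_le (G := ‖V.M'‖ * (‖V.U₀‖ + N)) (δ := ‖V.M'‖ * Δ)
    (V.integrableOn_clm_prim V.κ' hτ hz) (V.integrableOn_clm_prim V.κ' hτ hz')
    (V.continuousOn_clm_prim V.M' hτ hz) (V.continuousOn_clm_prim V.M' hτ hz') ht
    (fun s hs => V.M'.le_opNorm_of_le (hB s hs))
    (fun s hs => by rw [← map_sub]; exact V.M'.le_opNorm_of_le (hU s hs))
  have hc1' := hc1.trans (add_le_add (mul_le_mul_of_nonneg_left hκ1 (by positivity))
    (mul_le_mul_of_nonneg_left hκ2 (by positivity)))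
  have hc2' := hc2.trans (add_le_add (mul_le_mul_of_nonneg_left hκ'1 (by positivity))
    (mul_le_mul_of_nonneg_left hκ'2 (by positivity)))
  have e : V.op z t - V.op z' t = (V.P (V.prim z t) - V.P (V.prim z' t))
      + (conv (fun s => V.κ (z s)) (fun s => V.M (V.prim z s)) t
        - conv (fun s => V.κ (z' s)) (fun s => V.M (V.prim z' s)) t)
      + (conv (fun s => V.κ' (V.prim z s)) (fun s => V.M' (V.prim z s)) t
        - conv (fun s => V.κ' (V.prim z' s)) (fun s => V.M' (V.prim z' s)) t) := by
    simp only [op]; abel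
  rw [e]
  refine (norm_add₃_le).trans ((add_le_add (add_le_add hP hc1') hc2').trans_eq ?_)
  unfold lip
  ring

theorem norm_op_zero_le [CompleteSpace Y] (hτ1 : τ ≤ 1) {t : ℝ} (ht : t ∈ Icc 0 τ) :
    ‖V.op 0 t‖ ≤ ‖V.P‖ * ‖V.U₀‖ + (‖V.κ'‖ * ‖V.U₀‖) * (‖V.M'‖ * ‖V.U₀‖) := by
  have hp : ∀ s, V.prim 0 s = V.U₀ := fun s => by simp [prim]
  have h1 : V.op 0 t = V.P V.U₀ + t • (V.κ' V.U₀ • V.M' V.U₀) := by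
    simp [op, hp, conv, smul_comm t]
  rw [h1]
  refine (norm_add_le _ _).trans (add_le_add (V.P.le_opNorm _) ?_)
  rw [norm_smul, norm_smul, Real.norm_eq_abs, abs_of_nonneg ht.1]
  have h2 : ‖V.κ' V.U₀‖ * ‖V.M' V.U₀‖ ≤ (‖V.κ'‖ * ‖V.U₀‖) * (‖V.M'‖ * ‖V.U₀‖) :=
    mul_le_mul (V.κ'.le_opNorm _) (V.M'.le_opNorm _) (norm_nonneg _) (by positivity)
  have h3 : 0 ≤ ‖V.κ' V.U₀‖ * ‖V.M' V.U₀‖ := by positivity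
  nlinarith [ht.1, ht.2]

/-- Local solvability of the Volterra equation; the solution is the forcing term plus a
continuous function. -/
theorem exists_solution [CompleteSpace Y] {T : ℝ} (hT : 0 < T) {c : ℝ → Y}
    (hc : IntegrableOn c (Ioo 0 T)) :
    ∃ τ : ℝ, 0 < τ ∧ τ < T ∧ τ ≤ 1 ∧ ∃ w : ℝ → Y, Continuous w ∧
      ∀ t ∈ Icc 0 τ, w t = V.op (fun s => c s + w s) t := by
  -- `N` bounds the `L¹`-norm of `c + w` on `(0, τ)` for all `w` with `‖w‖ ≤ R`, once `τ R ≤ 1`.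
  set N : ℝ := (∫ s in Ioo 0 T, ‖c s‖) + 1 with hN
  have hN0 : 0 ≤ N := by
    have : 0 ≤ ∫ s in Ioo 0 T, ‖c s‖ := integral_nonneg fun _ => norm_nonneg _
    linarith
  set K := V.lip N with hK
  have hK0 : 0 ≤ K := V.lip_nonneg hN0
  -- A bound for `op 0` plus the Lipschitz constant times `N`: it bounds `op z` whenever the
  -- `L¹`-norm of `z` is at most `N`. It does not depend on `τ`, so `τ` may be chosen after it.
  set R : ℝ := (‖V.P‖ * ‖V.U₀‖ + (‖V.κ'‖ * ‖V.U₀‖) * (‖V.M'‖ * ‖V.U₀‖)) + K * N with hR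
  have hR0 : 0 ≤ R := by positivity
  -- The four bounds give `τ ≤ 1`, `τ < T`, `τ R ≤ 1` (the ball is mapped to itself) and `K τ ≤ 1/2`
  -- (contraction).
  set τ : ℝ := min (min 1 (T / 2)) (min (1 / (R + 1)) (1 / (2 * (K + 1)))) with hτdef
  have hτ : 0 < τ := by
    refine lt_min (lt_min one_pos (by linarith)) (lt_min (by positivity) (by positivity))
  have hτ1 : τ ≤ 1 := (min_le_left _ _).trans (min_le_left _ _)
  have hτT : τ < T := by
    have : τ ≤ T / 2 := (min_le_left _ _).trans (min_le_right _ _)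
    linarith
  have hτR : τ * R ≤ 1 := by
    have : τ ≤ 1 / (R + 1) := (min_le_right _ _).trans (min_le_left _ _)
    rw [le_div_iff₀ (by positivity)] at this
    nlinarith
  have hτK : K * τ ≤ 1 / 2 := by
    have : τ ≤ 1 / (2 * (K + 1)) := (min_le_right _ _).trans (min_le_right _ _)
    rw [le_div_iff₀ (by positivity)] at this
    nlinarith
  refine ⟨τ, hτ, hτT, hτ1, ?_⟩
  have hcτ : IntegrableOn c (Ioo 0 τ) := hc.mono_set (Ioo_subset_Ioo_right hτT.le)
  have hcN : ∫ s in Ioo 0 τ, ‖c s‖ ≤ ∫ s in Ioo 0 T, ‖c s‖ :=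
    setIntegral_mono_set hc.norm (Filter.Eventually.of_forall fun _ => norm_nonneg _)
      (Ioo_subset_Ioo_right hτT.le).eventuallyLE
  let ext : C(Icc 0 τ, Y) → ℝ → Y := fun w => IccExtend hτ.le w
  have hextc : ∀ w, Continuous (ext w) := fun w => continuous_IccExtend_iff.2 w.continuous
  have hexti : ∀ w, IntegrableOn (ext w) (Ioo 0 τ) := fun w =>
    ((hextc w).integrableOn_Icc).mono_set Ioo_subset_Icc_self
  -- The forcing `c` is only integrable, but `op z` is continuous for integrable `z`; hence the
  -- fixed point is sought for `w = z - c` in the continuous functions.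
  let z : C(Icc 0 τ, Y) → ℝ → Y := fun w s => c s + ext w s
  have hz : ∀ w, IntegrableOn (z w) (Ioo 0 τ) := fun w => hcτ.add (hexti w)
  have hzN : ∀ w ∈ Metric.closedBall (0 : C(Icc 0 τ, Y)) R, ∫ s in Ioo 0 τ, ‖z w s‖ ≤ N := by
    intro w hw
    rw [mem_closedBall_zero_iff] at hw
    have h1 : ∫ s in Ioo 0 τ, ‖z w s‖ ≤ ∫ s in Ioo 0 τ, (‖c s‖ + R) := by
      refine integral_mono (hz w).norm (hcτ.norm.add (integrableOn_const (by simp))) fun s => ?_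
      exact (norm_add_le _ _).trans (add_le_add le_rfl ((w.norm_coe_le_norm _).trans hw))
    rw [integral_add hcτ.norm (integrableOn_const (by simp))] at h1
    have h2 : ∫ _s in Ioo 0 τ, R = τ * R := by simp [hτ.le]
    linarith
  let Φ : C(Icc 0 τ, Y) → C(Icc 0 τ, Y) := fun w =>
    ⟨(Icc 0 τ).domRestrict (V.op (z w)), (V.continuousOn_op hτ.le (hz w)).domRestrict⟩
  have hΦ : ∀ w t, Φ w t = V.op (z w) t := fun w t => rfl
  have hmaps : MapsTo Φ (Metric.closedBall 0 R) (Metric.closedBall 0 R) := by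
    intro w hw
    rw [mem_closedBall_zero_iff, ContinuousMap.norm_le _ hR0]
    intro t
    have h1 := V.norm_op_sub_le hτ1 (hz w) (z' := 0) (integrableOn_zero) (hzN w hw)
      (by simpa using hN0) t.2
    have h2 := V.norm_op_zero_le hτ1 t.2
    have h3 : ∫ s in (0 : ℝ)..t, ‖z w s - (0 : ℝ → Y) s‖ ≤ N := by
      refine le_trans (le_abs_self _) (le_trans ?_ (hzN w hw))
      have := norm_primitive_le (z := fun s => ‖z w s‖) (hz w).norm t.2
      simpa only [norm_norm, Real.norm_eq_abs, abs_norm, Pi.zero_apply, sub_zero] using this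
    have h4 : ‖V.op (z w) t‖ ≤ ‖V.op (z w) t - V.op 0 t‖ + ‖V.op 0 t‖ := by
      simpa using norm_add_le (V.op (z w) t - V.op 0 t) (V.op 0 t)
    have h5 := mul_le_mul_of_nonneg_left h3 hK0
    rw [hΦ]
    linarith
  have hcontr : ContractingWith (1 / 2) (hmaps.restrict Φ _ _) := by
    refine ⟨by norm_num, LipschitzWith.of_dist_le_mul fun w w' => ?_⟩
    rw [Subtype.dist_eq, Subtype.dist_eq, ContinuousMap.dist_le (by positivity)]
    intro t
    have h1 := V.norm_op_sub_le hτ1 (hz w) (hz w') (hzN w w.2) (hzN w' w'.2) t.2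
    have h2 : ∫ s in (0 : ℝ)..t, ‖z w s - z w' s‖ ≤ τ * dist (w : C(Icc 0 τ, Y)) w' := by
      have h := intervalIntegral.norm_integral_le_of_norm_le_const (a := 0) (b := (t : ℝ))
        (C := dist (w : C(Icc 0 τ, Y)) w')
        (f := fun s => ‖z w s - z w' s‖) (fun s _ => by
          simp only [z]
          rw [norm_norm, add_sub_add_left_eq_sub, ← dist_eq_norm]
          exact ContinuousMap.dist_apply_le_dist _)
      rw [sub_zero, abs_of_nonneg t.2.1, mul_comm] at h
      exact (le_abs_self _).trans (h.trans (mul_le_mul_of_nonneg_right t.2.2 dist_nonneg))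
    rw [dist_eq_norm]
    refine h1.trans ((mul_le_mul_of_nonneg_left h2 hK0).trans ?_)
    rw [← mul_assoc]
    refine mul_le_mul_of_nonneg_right (hτK.trans_eq ?_) dist_nonneg
    simp
  obtain ⟨w, -, hw, -⟩ := hcontr.exists_fixedPoint' Metric.isClosed_closedBall.isComplete hmaps
    (Metric.mem_closedBall_self hR0) (edist_ne_top _ _)
  refine ⟨ext w, hextc w, fun t ht => ?_⟩
  have h1 : Φ w ⟨t, ht⟩ = w ⟨t, ht⟩ := by rw [hw.eq]
  have h2 : ext w t = w ⟨t, ht⟩ := IccExtend_of_mem hτ.le w ht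
  rw [h2, ← h1]
  exact hΦ w ⟨t, ht⟩

/-- With `N` the larger of the two `L¹`-norms, the Lipschitz estimate bounds `‖z - z'‖` by a
multiple of its own primitive. The only smallness needed is `τ ≤ 1`. -/
theorem ae_eq_of_solution {z z' c : ℝ → Y} (hτ : 0 ≤ τ) (hτ1 : τ ≤ 1)
    (hz : IntegrableOn z (Ioo 0 τ)) (hz' : IntegrableOn z' (Ioo 0 τ))
    (h : ∀ᵐ t ∂volume.restrict (Ioo 0 τ), z t = c t + V.op z t)
    (h' : ∀ᵐ t ∂volume.restrict (Ioo 0 τ), z' t = c t + V.op z' t) :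
    z =ᵐ[volume.restrict (Ioo 0 τ)] z' := by
  set N := max (∫ s in Ioo 0 τ, ‖z s‖) (∫ s in Ioo 0 τ, ‖z' s‖) with hN
  have hN0 : 0 ≤ N := (integral_nonneg fun _ => norm_nonneg _).trans (le_max_left _ _)
  have := ae_eq_zero_of_le_mul_primitive hτ (hz.sub hz').norm (fun _ => norm_nonneg _)
    (V.lip_nonneg hN0) (by
      filter_upwards [h, h', ae_restrict_mem measurableSet_Ioo] with t ht ht' hmem
      have := V.norm_op_sub_le hτ1 hz hz' (le_max_left _ _) (le_max_right _ _)
        (Ioo_subset_Icc_self hmem)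
      simp only [Pi.sub_apply]
      conv_lhs => rw [ht, ht', add_sub_add_left_eq_sub]
      exact this)
  filter_upwards [this] with t ht
  exact sub_eq_zero.1 (norm_eq_zero.1 ht)

end VolterraData

/-- The values `(v, v_t, k, y'', f')`, or their time derivatives. -/
abbrev State (X : Type*) : Type _ := X × X × ℝ × ℝ × ℝ

/-- The coefficients and initial values of the system for `(v, k, y)` after inversion of the
spatial operator. -/
structure ReducedSystem (X : Type*) [NormedAddCommGroup X] [NormedSpace ℝ X] where
  (α k₀ G₀ c p q y₂ g₀ : ℝ)
  (L₁ L₂ : X →L[ℝ] ℝ)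
  S : X →L[ℝ] X
  (a e v₀ v₁ : X)

/-! ### From the reduced system to the Volterra equation -/

namespace ReducedSystem

variable {X : Type*} [NormedAddCommGroup X] [NormedSpace ℝ X] (R : ReducedSystem X)

variable (X) in
/-- The component `v`. -/
def projV : State X →L[ℝ] X := ContinuousLinearMap.fst ℝ _ _

variable (X) in
/-- The component `v_t`. -/
def projW : State X →L[ℝ] X :=
  (ContinuousLinearMap.fst ℝ _ _).comp (ContinuousLinearMap.snd ℝ _ _)

variable (X) in
/-- The component `k`. -/
def projK : State X →L[ℝ] ℝ :=
  (ContinuousLinearMap.fst ℝ _ _).comp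
    ((ContinuousLinearMap.snd ℝ _ _).comp (ContinuousLinearMap.snd ℝ _ _))

variable (X) in
/-- The component `y''`. -/
def projY : State X →L[ℝ] ℝ :=
  (ContinuousLinearMap.fst ℝ _ _).comp
    ((ContinuousLinearMap.snd ℝ _ _).comp
      ((ContinuousLinearMap.snd ℝ _ _).comp (ContinuousLinearMap.snd ℝ _ _)))

variable (X) in
/-- The component `f'`. -/
def projG : State X →L[ℝ] ℝ :=
  (ContinuousLinearMap.snd ℝ _ _).comp
    ((ContinuousLinearMap.snd ℝ _ _).comp
      ((ContinuousLinearMap.snd ℝ _ _).comp (ContinuousLinearMap.snd ℝ _ _)))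

@[simp] theorem projV_apply (z : State X) : projV X z = z.1 := rfl
@[simp] theorem projW_apply (z : State X) : projW X z = z.2.1 := rfl
@[simp] theorem projK_apply (z : State X) : projK X z = z.2.2.1 := rfl
@[simp] theorem projY_apply (z : State X) : projY X z = z.2.2.2.1 := rfl
@[simp] theorem projG_apply (z : State X) : projG X z = z.2.2.2.2 := rfl

/-- `α (L₁ v_t - k₀ L₁ v)`. -/
def rowK : State X →L[ℝ] ℝ := R.α • (R.L₁.comp (projW X) - R.k₀ • R.L₁.comp (projV X))

/-- `-α L₁ v`. -/
def kernelK : State X →L[ℝ] ℝ := -(R.α • R.L₁.comp (projV X))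

/-- `c (f' + L₂ v)`. -/
def flux : State X →L[ℝ] ℝ := R.c • (projG X + R.L₂.comp (projV X))

/-- The part of `y'''` depending on the current state. -/
def rowY : State X →L[ℝ] ℝ :=
  R.c • R.L₂.comp (projW X) - R.G₀ • R.rowK - R.k₀ • R.flux

/-- The part of `y'''` that is convolved with `k'`. -/
def kernelY : State X →L[ℝ] ℝ := -(R.G₀ • R.kernelK) - R.flux

/-- The part of `v_tt` depending on the current state. -/
def rowV : State X →L[ℝ] X :=
  R.S.comp (projV X) - (projK X).smulRight R.a + (R.p • R.rowY + R.q • projY X).smulRight R.e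

/-- The Volterra equation equivalent to the reduced system. -/
def volterra : VolterraData (State X) where
  U₀ := (R.v₀, R.v₁, R.k₀, R.y₂, R.g₀)
  P := (projW X).prod (R.rowV.prod (R.rowK.prod (R.rowY.prod 0)))
  -- Applied to `z` this component is `k'`, applied to `U` it is `k`. Accordingly `M` collects the
  -- convolutions with `k'`, which reach the `v_tt`-row through `p y'''`, and `M'` the convolution
  -- of `k` with `S v`.
  κ := projK X
  κ' := projK X
  M := (0 : State X →L[ℝ] X).prod
    ((R.p • R.kernelY).smulRight R.e |>.prod (R.kernelK.prod (R.kernelY.prod 0)))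
  M' := (0 : State X →L[ℝ] X).prod ((-(R.S.comp (projV X))).prod 0)

/-- The part of `y'''` depending on the measurement only. -/
def forcingY (f₂ f₄ : ℝ → ℝ) (t : ℝ) : ℝ := R.c * f₂ t - R.G₀ * (R.α * f₄ t)

/-- The part of the Volterra equation depending on the measurement only. -/
def forcing (f₂ f₄ : ℝ → ℝ) (t : ℝ) : State X :=
  (0, (R.p * R.forcingY f₂ f₄ t) • R.e, R.α * f₄ t, R.forcingY f₂ f₄ t, f₂ t)

variable {τ : ℝ}

theorem map_prim [CompleteSpace X] {Z : Type*} [NormedAddCommGroup Z] [NormedSpace ℝ Z]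
    [CompleteSpace Z] (L : State X →L[ℝ] Z)
    {z : ℝ → State X} (hz : IntegrableOn z (Ioo 0 τ)) {t : ℝ} (ht : t ∈ Icc 0 τ) :
    L (R.volterra.prim z t) = L R.volterra.U₀ + ∫ s in (0 : ℝ)..t, L (z s) := by
  rw [VolterraData.prim, map_add, L.intervalIntegral_comp_comm]
  exact intervalIntegrable_of_Ioo hz (left_mem_Icc.2 (ht.1.trans ht.2)) ht

theorem conv_add {Y : Type*} [NormedAddCommGroup Y] [NormedSpace ℝ Y] {a : ℝ → ℝ} {g g' : ℝ → Y}
    (ha : IntegrableOn a (Ioo 0 τ)) (hg : ContinuousOn g (Icc 0 τ))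
    (hg' : ContinuousOn g' (Icc 0 τ)) {t : ℝ} (ht : t ∈ Icc 0 τ) :
    conv a (fun s => g s + g' s) t = conv a g t + conv a g' t := by
  simp only [conv, smul_add]
  exact intervalIntegral.integral_add (intervalIntegrable_conv ha hg ht)
    (intervalIntegrable_conv ha hg' ht)

theorem conv_const_mul (r : ℝ) (a g : ℝ → ℝ) (t : ℝ) :
    conv a (fun s => r * g s) t = r * conv a g t := by
  simp only [conv, smul_eq_mul, ← intervalIntegral.integral_const_mul]
  exact intervalIntegral.integral_congr fun s _ => by ring

theorem conv_zero {Y : Type*} [NormedAddCommGroup Y] [NormedSpace ℝ Y] (a : ℝ → ℝ) (t : ℝ) :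
    conv a (fun _ => (0 : Y)) t = 0 := by
  simp [conv]

theorem map_op [CompleteSpace X] {Z : Type*} [NormedAddCommGroup Z] [NormedSpace ℝ Z]
    [CompleteSpace Z] (L : State X →L[ℝ] Z) {z : ℝ → State X} (hz : IntegrableOn z (Ioo 0 τ))
    {t : ℝ} (ht : t ∈ Icc 0 τ) :
    L (R.volterra.op z t) = L (R.volterra.P (R.volterra.prim z t))
      + conv (fun s => (z s).2.2.1) (fun s => L (R.volterra.M (R.volterra.prim z s))) t
      + conv (fun s => (R.volterra.prim z s).2.2.1)
        (fun s => L (R.volterra.M' (R.volterra.prim z s))) t := by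
  have hτ : 0 ≤ τ := ht.1.trans ht.2
  have hk : IntegrableOn (fun s => (z s).2.2.1) (Ioo 0 τ) :=
    VolterraData.integrableOn_clm (projK X) hz
  have hkU : IntegrableOn (fun s => (R.volterra.prim z s).2.2.1) (Ioo 0 τ) :=
    R.volterra.integrableOn_clm_prim (projK X) hτ hz
  rw [VolterraData.op, map_add, map_add,
    ← map_conv L hk
      (R.volterra.continuousOn_clm_prim R.volterra.M hτ hz) ht,
    ← map_conv L hkU
      (R.volterra.continuousOn_clm_prim R.volterra.M' hτ hz) ht]
  rfl

/-- The components of the Volterra equation. -/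
theorem eq_forcing_add_op_iff [CompleteSpace X] {z : ℝ → State X} (f₂ f₄ : ℝ → ℝ)
    (hz : IntegrableOn z (Ioo 0 τ)) {t : ℝ} (ht : t ∈ Icc 0 τ) :
    z t = R.forcing f₂ f₄ t + R.volterra.op z t ↔
      (z t).1 = (R.volterra.prim z t).2.1 ∧
      (z t).2.1 = R.S (R.volterra.prim z t).1 - (R.volterra.prim z t).2.2.1 • R.a
        - conv (fun s => (R.volterra.prim z s).2.2.1) (fun s => R.S (R.volterra.prim z s).1) t
        + (R.p * (z t).2.2.2.1 + R.q * (R.volterra.prim z t).2.2.2.1) • R.e ∧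
      (z t).2.2.1 = R.α * (f₄ t + R.L₁ (R.volterra.prim z t).2.1
        - R.k₀ * R.L₁ (R.volterra.prim z t).1
        - conv (fun s => (z s).2.2.1) (fun s => R.L₁ (R.volterra.prim z s).1) t) ∧
      (z t).2.2.2.1 = R.c * (f₂ t + R.L₂ (R.volterra.prim z t).2.1) - (z t).2.2.1 * R.G₀
        - R.k₀ * (R.c * ((R.volterra.prim z t).2.2.2.2 + R.L₂ (R.volterra.prim z t).1))
        - conv (fun s => (z s).2.2.1)
          (fun s => R.c * ((R.volterra.prim z s).2.2.2.2 + R.L₂ (R.volterra.prim z s).1)) t ∧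
      (z t).2.2.2.2 = f₂ t := by
  have hτ : 0 ≤ τ := ht.1.trans ht.2
  set U := R.volterra.prim z with hU
  have hk : IntegrableOn (fun s => (z s).2.2.1) (Ioo 0 τ) :=
    VolterraData.integrableOn_clm (projK X) hz
  have hcont : ∀ L : State X →L[ℝ] ℝ, ContinuousOn (fun s => L (U s)) (Icc 0 τ) := fun L =>
    R.volterra.continuousOn_clm_prim L hτ hz
  set q₁ := conv (fun s => (z s).2.2.1) (fun s => R.L₁ (U s).1) t with hq₁
  set q₂ := conv (fun s => (z s).2.2.1) (fun s => R.c * ((U s).2.2.2.2 + R.L₂ (U s).1)) t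
    with hq₂
  have hKc : conv (fun s => (z s).2.2.1) (fun s => R.kernelK (U s)) t = -(R.α * q₁) := by
    have : ∀ s, R.kernelK (U s) = (-R.α) * R.L₁ (U s).1 := fun s => by simp [kernelK]
    simp only [this]
    rw [conv_const_mul, neg_mul]
  have hYc : conv (fun s => (z s).2.2.1) (fun s => R.kernelY (U s)) t
      = R.G₀ * (R.α * q₁) - q₂ := by
    have : ∀ s, R.kernelY (U s) = (-R.G₀) * R.kernelK (U s)
        + (-1) * (R.c * ((U s).2.2.2.2 + R.L₂ (U s).1)) := fun s => by
      simp [kernelY, flux]; ring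
    simp only [this]
    rw [conv_add (g := fun s => (-R.G₀) * R.kernelK (U s))
      (g' := fun s => (-1) * (R.c * ((U s).2.2.2.2 + R.L₂ (U s).1))) hk (continuousOn_const.mul (hcont R.kernelK))
      (continuousOn_const.mul (hcont R.flux)) ht, conv_const_mul, conv_const_mul, hKc]
    ring
  have oV : (R.volterra.op z t).1 = (U t).2.1 := by
    have h := R.map_op (projV X) hz ht
    simp only [projV_apply, ← hU] at h
    rw [h]
    simp [volterra, conv_zero]
  have oK : (R.volterra.op z t).2.2.1 = R.rowK (U t) - R.α * q₁ := by
    have h := R.map_op (projK X) hz ht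
    simp only [projK_apply, ← hU] at h
    rw [h]
    simp only [volterra, ContinuousLinearMap.prod_apply]
    rw [hKc]
    simp [conv_zero, sub_eq_add_neg]
  have oY : (R.volterra.op z t).2.2.2.1 = R.rowY (U t) + (R.G₀ * (R.α * q₁) - q₂) := by
    have h := R.map_op (projY X) hz ht
    simp only [projY_apply, ← hU] at h
    rw [h]
    simp only [volterra, ContinuousLinearMap.prod_apply]
    rw [hYc]
    simp [conv_zero]
  have oG : (R.volterra.op z t).2.2.2.2 = 0 := by
    have h := R.map_op (projG X) hz ht
    simp only [projG_apply, ← hU] at h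
    rw [h]
    simp [volterra, conv_zero]
  have oW : (R.volterra.op z t).2.1 = R.rowV (U t)
      + (R.p * (R.G₀ * (R.α * q₁) - q₂)) • R.e
      - conv (fun s => (U s).2.2.1) (fun s => R.S (U s).1) t := by
    have h := R.map_op (projW X) hz ht
    simp only [projW_apply, ← hU] at h
    rw [h]
    have e1 : conv (fun s => (z s).2.2.1) (fun s => (R.volterra.M (U s)).2.1) t
        = (R.p * (R.G₀ * (R.α * q₁) - q₂)) • R.e := by
      rw [← hYc, ← conv_const_mul]
      simp only [conv]
      rw [← intervalIntegral.integral_smul_const]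
      refine intervalIntegral.integral_congr fun s _ => ?_
      simp [volterra, smul_smul]
    have e2 : conv (fun s => (U s).2.2.1) (fun s => (R.volterra.M' (U s)).2.1) t
        = -conv (fun s => (U s).2.2.1) (fun s => R.S (U s).1) t := by
      simp [conv, volterra]
    rw [e1, e2, ← sub_eq_add_neg]
    simp [volterra]
  have hrowK : R.rowK (U t) = R.α * (R.L₁ (U t).2.1 - R.k₀ * R.L₁ (U t).1) := by
    simp [rowK]
  have hrowY : R.rowY (U t) = R.c * R.L₂ (U t).2.1 - R.G₀ * R.rowK (U t)
      - R.k₀ * (R.c * ((U t).2.2.2.2 + R.L₂ (U t).1)) := by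
    simp only [rowY, flux, _root_.sub_apply, _root_.smul_apply,
      _root_.add_apply, ContinuousLinearMap.comp_apply, projW_apply, projV_apply,
      projG_apply, smul_eq_mul]
  have hrowV : R.rowV (U t) = R.S (U t).1 - (U t).2.2.1 • R.a
      + (R.p * R.rowY (U t) + R.q * (U t).2.2.2.1) • R.e := by
    simp [rowV]
  simp only [Prod.ext_iff, Prod.fst_add, Prod.snd_add, oV, oK, oY, oG, oW, forcing, forcingY,
    zero_add, add_zero, hrowV]
  -- The listed equations still contain `k'` in the `y`-row and `y'''` in the `v_tt`-row, while the
  -- Volterra form has them eliminated. Both directions substitute in the order `k'`, `y'''`,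
  -- `v_tt`.
  generalize R.rowY (U t) = rY at *
  generalize R.rowK (U t) = rK at *
  constructor
  · rintro ⟨h1, h2, h3, h4, h5⟩
    have h4' : (z t).2.2.2.1 = R.c * f₂ t - R.G₀ * (R.α * f₄ t)
        + (rY + (R.G₀ * (R.α * q₁) - q₂)) := h4
    refine ⟨h1, ?_, ?_, ?_, h5⟩
    · rw [h2, h4']; module
    · rw [h3, hrowK]; ring
    · rw [h4, hrowY, h3]; ring
  · rintro ⟨h1, h2, h3, h4, h5⟩
    have h3' : (z t).2.2.1 = R.α * f₄ t + (rK - R.α * q₁) := by rw [h3, hrowK]; ring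
    have h4' : (z t).2.2.2.1 = R.c * f₂ t - R.G₀ * (R.α * f₄ t)
        + (rY + (R.G₀ * (R.α * q₁) - q₂)) := by rw [h4, hrowY, h3']; ring
    refine ⟨h1, ?_, h3', h4', h5⟩
    rw [h2, h4']; module

/-- The forcing is `f₂(t) a₂ + f₄(t) a₄` with two fixed vectors. Square integrability is what later
places `v_tt`, `k'` and `y'''` in `L²`. -/
theorem memLp_forcing {f₂ f₄ : ℝ → ℝ} {μ : Measure ℝ} (h₂ : MemLp f₂ 2 μ) (h₄ : MemLp f₄ 2 μ) :
    MemLp (R.forcing f₂ f₄) 2 μ := by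
  let a₂ : State X := (0, (R.p * R.c) • R.e, 0, R.c, 1)
  let a₄ : State X := (0, (-(R.p * R.G₀ * R.α)) • R.e, R.α, -(R.G₀ * R.α), 0)
  have h := (((1 : ℝ →L[ℝ] ℝ).smulRight a₂).comp_memLp' h₂).add
    (((1 : ℝ →L[ℝ] ℝ).smulRight a₄).comp_memLp' h₄)
  refine (memLp_congr_ae (Filter.Eventually.of_forall fun t => ?_)).1 h
  symm
  simp only [forcing, forcingY, a₂, a₄, Pi.add_apply, Function.comp_apply,
    ContinuousLinearMap.smulRight_apply, one_apply_eq_self, Prod.smul_mk,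
    Prod.mk_add_mk, Prod.mk.injEq, smul_eq_mul, smul_zero, add_zero, true_and]
  refine ⟨?_, ?_, ?_, ?_⟩
  · module
  · ring
  · ring
  · ring

end ReducedSystem

/-! ### Pairings in `L²` and the wave equation as an identity in `L²` -/

section Pairing

variable {ℓ : ℝ}

theorem inner_eq_intervalIntegral (hℓ : 0 ≤ ℓ) (f g : Lp ℝ 2 (volume.restrict (Ioo 0 ℓ))) :
    inner ℝ f g = ∫ x in (0 : ℝ)..ℓ, g x * f x := by
  rw [L2.inner_def, intervalIntegral_eq_setIntegral_Ioo hℓ]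
  rfl

theorem memLp_ramp (ℓ : ℝ) : MemLp (fun x : ℝ => x / ℓ) 2 (volume.restrict (Ioo 0 ℓ)) :=
  memLp_two_of_continuousOn (by fun_prop)

/-- The function `x / ℓ` as an element of `L²`. -/
def ramp (ℓ : ℝ) : Lp ℝ 2 (volume.restrict (Ioo 0 ℓ)) := (memLp_ramp ℓ).toLp

theorem ae_pde_iff (a b c d e : Lp ℝ 2 (volume.restrict (Ioo 0 ℓ))) (β k r : ℝ) :
    (∀ᵐ x ∂volume.restrict (Ioo 0 ℓ), a x - b x - β * c x + k * d x + e x = r * (x / ℓ)) ↔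
      a - b - β • c + k • d + e = r • ramp ℓ := by
  have h1 : ∀ᵐ x ∂volume.restrict (Ioo 0 ℓ),
      (a - b - β • c + k • d + e : Lp ℝ 2 (volume.restrict (Ioo 0 ℓ))) x
        = a x - b x - β * c x + k * d x + e x := by
    filter_upwards [Lp.coeFn_add (a - b - β • c + k • d) e, Lp.coeFn_add (a - b - β • c) (k • d),
      Lp.coeFn_sub (a - b) (β • c), Lp.coeFn_sub a b, Lp.coeFn_smul β c, Lp.coeFn_smul k d]
      with x h1 h2 h3 h4 h5 h6
    rw [h1, Pi.add_apply, h2, Pi.add_apply, h3, Pi.sub_apply, h4, Pi.sub_apply, h5, h6]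
    rfl
  have h2 : ∀ᵐ x ∂volume.restrict (Ioo 0 ℓ),
      (r • ramp ℓ : Lp ℝ 2 (volume.restrict (Ioo 0 ℓ))) x = r * (x / ℓ) := by
    filter_upwards [Lp.coeFn_smul r (ramp ℓ), (memLp_ramp ℓ).coeFn_toLp] with x h1 h2
    rw [h1, Pi.smul_apply, smul_eq_mul, ramp, h2]
  constructor
  · intro h
    apply Lp.ext
    filter_upwards [h, h1, h2] with x hx hx1 hx2
    rw [hx1, hx2, hx]
  · intro h
    filter_upwards [h1, h2] with x hx1 hx2
    rw [← hx1, ← hx2, h]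

end Pairing

/-! ### The reduced system of the data and its equivalence with the equations -/

namespace Data

variable {ℓ T : ℝ} (D : Data ℓ T)

/-- The functional `w ↦ ∫ w φ'''`. -/
def sensor : H01H2 ℓ →L[ℝ] ℝ := (innerSL ℝ (wderiv D.φ 3)).comp (xderivCLM ℓ 0)

theorem sensor_apply (hℓ : 0 ≤ ℓ) (w : H01H2 ℓ) :
    D.sensor w = ∫ x in (0 : ℝ)..ℓ, (xderiv w 0) x * (wderiv D.φ 3) x :=
  inner_eq_intervalIntegral hℓ _ _

/-- `φ'` has a continuous representative, with which `valueAt` agrees at every point of `[0, ℓ]`; so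
`ψ` is continuous there. -/
theorem memLp_ψ (hℓ : 0 < ℓ) (hφ : IsH03 D.φ) : MemLp D.ψ 2 (volume.restrict (Ioo 0 ℓ)) := by
  obtain ⟨w, hw, hwφ, -⟩ := (hφ 1 (by norm_num)).1
  have h1 : ContinuousOn (fun x => ∫ s in (0 : ℝ)..x, (wderiv D.φ 0) s) (Icc 0 ℓ) :=
    continuousOn_primitive_Ioo hℓ.le (integrableOn_Lp _)
  refine memLp_two_of_continuousOn ((h1.sub ((continuousOn_const (c := D.β)).mul hw)).congr fun x hx => ?_)
  rw [ψ, valueAt_eq hℓ hx hw hwφ]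
  rfl

variable {D}

/-- The functional `w ↦ ∫ ψ w''`. -/
def fluxFunctional (hψ : MemLp D.ψ 2 (volume.restrict (Ioo 0 ℓ))) : H01H2 ℓ →L[ℝ] ℝ :=
  (innerSL ℝ hψ.toLp).comp (xderivCLM ℓ 2)

theorem fluxFunctional_apply (hℓ : 0 ≤ ℓ) (hψ : MemLp D.ψ 2 (volume.restrict (Ioo 0 ℓ)))
    (w : H01H2 ℓ) : fluxFunctional hψ w = ∫ x in (0 : ℝ)..ℓ, D.ψ x * (xderiv w 2) x := by
  have : fluxFunctional hψ w = inner ℝ hψ.toLp (xderiv w 2) := rfl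
  rw [this, inner_eq_intervalIntegral hℓ, intervalIntegral_eq_setIntegral_Ioo hℓ,
    intervalIntegral_eq_setIntegral_Ioo hℓ]
  refine integral_congr_ae ?_
  filter_upwards [hψ.coeFn_toLp] with x hx
  rw [hx, mul_comm]

/-- The reduced system of the data, with `g₀` the initial value of `f'`. -/
def reduced (hℓ : 0 < ℓ) (hβ : 0 < D.β) (hψ : MemLp D.ψ 2 (volume.restrict (Ioo 0 ℓ)))
    (g₀ : ℝ) : ReducedSystem (H01H2 ℓ) where
  α := D.α
  k₀ := D.kZero
  G₀ := D.GHatZero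
  c := (D.ψ ℓ)⁻¹
  p := D.p
  q := D.q
  y₂ := D.ySecondZero
  g₀ := g₀
  L₁ := D.sensor
  L₂ := fluxFunctional hψ
  S := (helmholtzInv hℓ hβ).comp (xderivCLM ℓ 2)
  a := helmholtzInv hℓ hβ (wderiv D.u₀ 2)
  e := helmholtzInv hℓ hβ (ramp ℓ)
  v₀ := D.v₀
  v₁ := D.v₁

/-- The classes `v`, `k`, `y` and `f` are given by the components of `U` and of its derivative
`z`. -/
structure Represents {τ : ℝ} (D : Data ℓ T) (z U : ℝ → State (H01H2 ℓ))
    (v : SobolevH (H01H2 ℓ) 2 0 τ) (k : SobolevH ℝ 1 0 τ) (y : SobolevH ℝ 3 0 τ) : Prop where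
  v_zero : ∀ᵐ t ∂volume.restrict (Ioo 0 τ), (wderiv v 0) t = (U t).1
  v_one : ∀ᵐ t ∂volume.restrict (Ioo 0 τ), (wderiv v 1) t = (U t).2.1
  v_two : ∀ᵐ t ∂volume.restrict (Ioo 0 τ), (wderiv v 2) t = (z t).2.1
  k_zero : ∀ᵐ t ∂volume.restrict (Ioo 0 τ), (wderiv k 0) t = (U t).2.2.1
  k_one : ∀ᵐ t ∂volume.restrict (Ioo 0 τ), (wderiv k 1) t = (z t).2.2.1
  y_two : ∀ᵐ t ∂volume.restrict (Ioo 0 τ), (wderiv y 2) t = (U t).2.2.2.1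
  y_three : ∀ᵐ t ∂volume.restrict (Ioo 0 τ), (wderiv y 3) t = (z t).2.2.2.1
  f_one : ∀ᵐ t ∂volume.restrict (Ioo 0 τ), (wderiv D.f 1) t = (U t).2.2.2.2

section Equations

variable {τ : ℝ} {z U : ℝ → State (H01H2 ℓ)} {v : SobolevH (H01H2 ℓ) 2 0 τ}
  {k : SobolevH ℝ 1 0 τ} {y : SobolevH ℝ 3 0 τ} (hℓ : 0 < ℓ) (hβ : 0 < D.β) (hψ : MemLp D.ψ 2 (volume.restrict (Ioo 0 ℓ))) (g₀ : ℝ)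

/-- For almost every fixed `t` the equation is solved for `(1 - β d²/dx²) v_tt` and the bounded
operator `helmholtzInv` is applied; it passes through the time integral, a Bochner integral in `L²`.
-/
theorem Represents.pde_iff (hrep : D.Represents z U v k y) (hU : ContinuousOn U (Icc 0 τ)) :
    ∀ᵐ t ∂volume.restrict (Ioo 0 τ),
    ((∀ᵐ x ∂volume.restrict (Ioo 0 ℓ),
      (xderiv ((wderiv v 2) t) 0) x - (xderiv ((wderiv v 0) t) 2) x
        - D.β * (xderiv ((wderiv v 2) t) 2) x
        + (wderiv k 0) t * (wderiv D.u₀ 2) x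
        + (∫ s in (0 : ℝ)..t, (wderiv k 0) (t - s) • xderiv ((wderiv v 0) s) 2 :
            Lp ℝ 2 (volume.restrict (Ioo 0 ℓ))) x
      = (D.p * (wderiv y 3) t + D.q * (wderiv y 2) t) * (x / ℓ)) ↔
    (z t).2.1 = (reduced hℓ hβ hψ g₀).S (U t).1 - (U t).2.2.1 • (reduced hℓ hβ hψ g₀).a
        - conv (fun s => (U s).2.2.1) (fun s => (reduced hℓ hβ hψ g₀).S (U s).1) t
        + ((reduced hℓ hβ hψ g₀).p * (z t).2.2.2.1
          + (reduced hℓ hβ hψ g₀).q * (U t).2.2.2.1) • (reduced hℓ hβ hψ g₀).e) := by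
  have := completeSpace_H01H2 hℓ
  filter_upwards [hrep.v_zero, hrep.v_two, hrep.k_zero, hrep.y_two, hrep.y_three,
    ae_restrict_mem measurableSet_Ioo] with t h1 h2 h3 h4 h5 hmem
  have ht := Ioo_subset_Icc_self hmem
  have hτ : 0 ≤ τ := ht.1.trans ht.2
  have hki : IntegrableOn (fun s => (U s).2.2.1) (Ioo 0 τ) :=
    ((ReducedSystem.projK _).continuous.comp_continuousOn hU).integrableOn_Icc.mono_set
      Ioo_subset_Icc_self
  have hvc : ContinuousOn (fun s => xderivCLM ℓ 2 le_rfl (U s).1) (Icc 0 τ) :=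
    ((xderivCLM ℓ 2).comp (ReducedSystem.projV _)).continuous.comp_continuousOn hU
  have hI : (∫ s in (0 : ℝ)..t, (wderiv k 0) (t - s) • xderiv ((wderiv v 0) s) 2 :
      Lp ℝ 2 (volume.restrict (Ioo 0 ℓ)))
      = conv (fun s => (U s).2.2.1) (fun s => xderivCLM ℓ 2 le_rfl (U s).1) t := by
    refine conv_congr_ae (τ := τ) (a := wderiv k 0) (g := fun s => xderiv ((wderiv v 0) s) 2) ht
      hrep.k_zero ?_
    filter_upwards [hrep.v_zero] with s hs
    rw [hs]
    rfl
  rw [ae_pde_iff, hI, h1, h2, h3, h4, h5]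
  have hSI : conv (fun s => (U s).2.2.1) (fun s => (reduced hℓ hβ hψ g₀).S (U s).1) t
      = helmholtzInv hℓ hβ
        (conv (fun s => (U s).2.2.1) (fun s => xderivCLM ℓ 2 le_rfl (U s).1) t) :=
    (map_conv (helmholtzInv hℓ hβ) hki hvc ht).symm
  rw [hSI]
  set I := conv (fun s => (U s).2.2.1) (fun s => xderivCLM ℓ 2 le_rfl (U s).1) t
  set r := D.p * (z t).2.2.2.1 + D.q * (U t).2.2.2.1 with hr
  have hR : (reduced hℓ hβ hψ g₀).S (U t).1 - (U t).2.2.1 • (reduced hℓ hβ hψ g₀).a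
        - helmholtzInv hℓ hβ I
        + ((reduced hℓ hβ hψ g₀).p * (z t).2.2.2.1
          + (reduced hℓ hβ hψ g₀).q * (U t).2.2.2.1) • (reduced hℓ hβ hψ g₀).e
      = helmholtzInv hℓ hβ (xderiv (U t).1 2 - (U t).2.2.1 • wderiv D.u₀ 2 - I + r • ramp ℓ) := by
    rw [map_add, map_sub, map_sub, map_smul, map_smul]
    rfl
  rw [hR, eq_helmholtzInv_iff, helmholtz_apply]
  constructor
  · intro h; rw [← h]; module
  · intro h
    have : xderiv (z t).2.1 0 - xderiv (U t).1 2 - D.β • xderiv (z t).2.1 2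
        + (U t).2.2.1 • wderiv D.u₀ 2 + I
        = (xderiv (z t).2.1 0 - D.β • xderiv (z t).2.1 2) - xderiv (U t).1 2
        + (U t).2.2.1 • wderiv D.u₀ 2 + I := by module
    rw [this, h]; module

theorem Represents.k_iff (hrep : D.Represents z U v k y) : ∀ᵐ t ∂volume.restrict (Ioo 0 τ),
    ((wderiv k 1) t = D.α * ((wderiv D.f 4) t
      + (∫ x in (0 : ℝ)..ℓ, (xderiv ((wderiv v 1) t) 0) x * (wderiv D.φ 3) x)
      - D.kZero * (∫ x in (0 : ℝ)..ℓ, (xderiv ((wderiv v 0) t) 0) x * (wderiv D.φ 3) x)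
      - ∫ s in (0 : ℝ)..t, ∫ x in (0 : ℝ)..ℓ,
          (wderiv k 1) (t - s) * (xderiv ((wderiv v 0) s) 0) x * (wderiv D.φ 3) x) ↔
    (z t).2.2.1 = (reduced hℓ hβ hψ g₀).α * ((wderiv D.f 4) t
        + (reduced hℓ hβ hψ g₀).L₁ (U t).2.1
        - (reduced hℓ hβ hψ g₀).k₀ * (reduced hℓ hβ hψ g₀).L₁ (U t).1
        - conv (fun s => (z s).2.2.1) (fun s => (reduced hℓ hβ hψ g₀).L₁ (U s).1) t)) := by
  filter_upwards [hrep.v_zero, hrep.v_one, hrep.k_one,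
    ae_restrict_mem measurableSet_Ioo] with t h1 h2 h3 hmem
  have ht := Ioo_subset_Icc_self hmem
  have hI : ∫ s in (0 : ℝ)..t, ∫ x in (0 : ℝ)..ℓ,
      (wderiv k 1) (t - s) * (xderiv ((wderiv v 0) s) 0) x * (wderiv D.φ 3) x
      = conv (fun s => (z s).2.2.1) (fun s => (reduced hℓ hβ hψ g₀).L₁ (U s).1) t := by
    simp only [mul_assoc, intervalIntegral.integral_const_mul, ← D.sensor_apply hℓ.le]
    refine conv_congr_ae (τ := τ) (a := wderiv k 1) (g := fun s => D.sensor ((wderiv v 0) s)) ht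
      hrep.k_one ?_
    filter_upwards [hrep.v_zero] with s hs
    rw [hs]
    rfl
  rw [hI, ← D.sensor_apply hℓ.le, ← D.sensor_apply hℓ.le, h1, h2, h3]
  rfl

theorem Represents.y_iff (hrep : D.Represents z U v k y) : ∀ᵐ t ∂volume.restrict (Ioo 0 τ),
    ((wderiv y 3) t = D.GPrime v t - (wderiv k 1) t * D.GHatZero - D.kZero * D.G v t
      - ∫ s in (0 : ℝ)..t, (wderiv k 1) (t - s) * D.G v s ↔
    (z t).2.2.2.1 = (reduced hℓ hβ hψ g₀).c * ((wderiv D.f 2) t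
          + (reduced hℓ hβ hψ g₀).L₂ (U t).2.1) - (z t).2.2.1 * (reduced hℓ hβ hψ g₀).G₀
        - (reduced hℓ hβ hψ g₀).k₀ * ((reduced hℓ hβ hψ g₀).c * ((U t).2.2.2.2
          + (reduced hℓ hβ hψ g₀).L₂ (U t).1))
        - conv (fun s => (z s).2.2.1) (fun s => (reduced hℓ hβ hψ g₀).c * ((U s).2.2.2.2
          + (reduced hℓ hβ hψ g₀).L₂ (U s).1)) t) := by
  have hG : ∀ᵐ t ∂volume.restrict (Ioo 0 τ), D.G v t
      = (reduced hℓ hβ hψ g₀).c * ((U t).2.2.2.2 + (reduced hℓ hβ hψ g₀).L₂ (U t).1) := by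
    filter_upwards [hrep.v_zero, hrep.f_one] with t h1 h2
    rw [G, ← fluxFunctional_apply hℓ.le hψ, h1, h2]
    rfl
  filter_upwards [hG, hrep.v_one, hrep.k_one, hrep.y_three,
    ae_restrict_mem measurableSet_Ioo] with t h1 h2 h3 h4 hmem
  have ht := Ioo_subset_Icc_self hmem
  have hI : ∫ s in (0 : ℝ)..t, (wderiv k 1) (t - s) * D.G v s
      = conv (fun s => (z s).2.2.1) (fun s => (reduced hℓ hβ hψ g₀).c * ((U s).2.2.2.2
          + (reduced hℓ hβ hψ g₀).L₂ (U s).1)) t :=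
    conv_congr_ae (τ := τ) (a := wderiv k 1) (g := D.G v) ht hrep.k_one hG
  rw [hI, h1, h3, h4, GPrime, ← fluxFunctional_apply hℓ.le hψ, h2]
  rfl

end Equations

end Data

theorem hasWeakDeriv_toLp {E : Type*} [NormedAddCommGroup E] [NormedSpace ℝ E] [CompleteSpace E]
    {a b : ℝ} {u g : ℝ → E} (hu : MemLp u 2 (volume.restrict (Ioo a b)))
    (hg : MemLp g 2 (volume.restrict (Ioo a b))) (C : E)
    (h : ∀ᵐ t ∂volume.restrict (Ioo a b), u t = C + ∫ s in a..t, g s) :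
    HasWeakDeriv a b hu.toLp hg.toLp :=
  (hasWeakDeriv_of_ae_eq_primitive C (hg.integrable (by norm_num)) h).congr hu.coeFn_toLp.symm
    hg.coeFn_toLp.symm

/-! ### Solutions of the problem and solutions of the Volterra equation -/

namespace Data

open ReducedSystem

variable {ℓ T τ : ℝ} {D : Data ℓ T}

theorem ae_of_lt {p : ℝ → Prop} (hτT : τ ≤ T) (h : ∀ᵐ t ∂volume.restrict (Ioo 0 T), p t) :
    ∀ᵐ t ∂volume.restrict (Ioo 0 τ), p t :=
  ae_restrict_of_ae_restrict_of_subset (Ioo_subset_Ioo_right hτT) h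

/-- The time derivative of the state belonging to `(v, k, y)`. -/
def stateDeriv (D : Data ℓ T) (v : SobolevH (H01H2 ℓ) 2 0 τ) (k : SobolevH ℝ 1 0 τ)
    (y : SobolevH ℝ 3 0 τ) (t : ℝ) : State (H01H2 ℓ) :=
  ((wderiv v 1) t, (wderiv v 2) t, (wderiv k 1) t, (wderiv y 3) t, (wderiv D.f 2) t)

theorem integrableOn_stateDeriv (hτT : τ ≤ T) (v : SobolevH (H01H2 ℓ) 2 0 τ)
    (k : SobolevH ℝ 1 0 τ) (y : SobolevH ℝ 3 0 τ) :
    IntegrableOn (D.stateDeriv v k y) (Ioo 0 τ) :=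
  (integrableOn_Lp _).prodMk ((integrableOn_Lp _).prodMk ((integrableOn_Lp _).prodMk
    ((integrableOn_Lp _).prodMk
      ((integrableOn_Lp (wderiv D.f 2)).mono_set (Ioo_subset_Ioo_right hτT)))))

variable (hℓ : 0 < ℓ) (hβ : 0 < D.β) (hψ : MemLp D.ψ 2 (volume.restrict (Ioo 0 ℓ))) {g₀ : ℝ}

/-- The initial conditions enter here: they are the constants with which `v`, `v_t`, `k` and `y''`
are primitives of their weak derivatives, that is, the components of `U₀`. -/
theorem IsSolution.represents (hτ : 0 < τ) (hτT : τ ≤ T)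
    (hf : ∀ᵐ t ∂volume.restrict (Ioo 0 T),
      (wderiv D.f 1) t = g₀ + ∫ s in (0 : ℝ)..t, (wderiv D.f 2) s)
    {v : SobolevH (H01H2 ℓ) 2 0 τ} {k : SobolevH ℝ 1 0 τ} {y : SobolevH ℝ 3 0 τ}
    (h : D.IsSolution v k y) :
    D.Represents (D.stateDeriv v k y)
      ((reduced hℓ hβ hψ g₀).volterra.prim (D.stateDeriv v k y)) v k y := by
  have := completeSpace_H01H2 hℓ
  have hz := integrableOn_stateDeriv (D := D) hτT v k y
  set R := reduced hℓ hβ hψ g₀ with hR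
  have hmem : ∀ᵐ t ∂volume.restrict (Ioo 0 τ), t ∈ Ioo 0 τ := ae_restrict_mem measurableSet_Ioo
  constructor
  · filter_upwards [wderiv_ae_eq_primitive hτ v 0 (by norm_num) h.v_init, hmem] with t ht hm
    exact ht.trans (R.map_prim (projV _) hz (Ioo_subset_Icc_self hm)).symm
  · filter_upwards [wderiv_ae_eq_primitive hτ v 1 (by norm_num) h.vt_init, hmem] with t ht hm
    exact ht.trans (R.map_prim (projW _) hz (Ioo_subset_Icc_self hm)).symm
  · exact Filter.Eventually.of_forall fun _ => rfl
  · filter_upwards [wderiv_ae_eq_primitive hτ k 0 (by norm_num) h.k_init, hmem] with t ht hm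
    exact ht.trans (R.map_prim (projK _) hz (Ioo_subset_Icc_self hm)).symm
  · exact Filter.Eventually.of_forall fun _ => rfl
  · filter_upwards [wderiv_ae_eq_primitive hτ y 2 (by norm_num) h.y_init, hmem] with t ht hm
    exact ht.trans (R.map_prim (projY _) hz (Ioo_subset_Icc_self hm)).symm
  · exact Filter.Eventually.of_forall fun _ => rfl
  · filter_upwards [ae_of_lt hτT hf, hmem] with t ht hm
    exact ht.trans (R.map_prim (projG _) hz (Ioo_subset_Icc_self hm)).symm

theorem IsSolution.ae_eq_forcing_add_op (hτ : 0 < τ) (hτT : τ ≤ T)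
    (hf : ∀ᵐ t ∂volume.restrict (Ioo 0 T),
      (wderiv D.f 1) t = g₀ + ∫ s in (0 : ℝ)..t, (wderiv D.f 2) s)
    {v : SobolevH (H01H2 ℓ) 2 0 τ} {k : SobolevH ℝ 1 0 τ} {y : SobolevH ℝ 3 0 τ}
    (h : D.IsSolution v k y) :
    ∀ᵐ t ∂volume.restrict (Ioo 0 τ), D.stateDeriv v k y t
      = (reduced hℓ hβ hψ g₀).forcing (wderiv D.f 2) (wderiv D.f 4) t
        + (reduced hℓ hβ hψ g₀).volterra.op (D.stateDeriv v k y) t := by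
  have := completeSpace_H01H2 hℓ
  have hz := integrableOn_stateDeriv (D := D) hτT v k y
  have hrep := h.represents hℓ hβ hψ hτ hτT hf
  filter_upwards [hrep.pde_iff hℓ hβ hψ g₀ (VolterraData.continuousOn_prim _ hτ.le hz),
    hrep.k_iff hℓ hβ hψ g₀, hrep.y_iff hℓ hβ hψ g₀, h.pde, h.k_eq, h.y_eq, hrep.v_one,
    ae_restrict_mem measurableSet_Ioo] with t h1 h2 h3 h4 h5 h6 h7 hm
  rw [(reduced hℓ hβ hψ g₀).eq_forcing_add_op_iff _ _ hz (Ioo_subset_Icc_self hm)]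
  exact ⟨h7, h1.1 h4, h2.1 h5, h3.1 h6, rfl⟩

/-- Equality of the state derivatives gives the higher derivatives at once and, by integration from
common initial values, `v` and `k`. Nothing is claimed for `y`, whose values `y(0)` and `y'(0)` are
free. -/
theorem IsSolution.unique (hℓ : 0 < ℓ) (hβ : 0 < D.β)
    (hψ : MemLp D.ψ 2 (volume.restrict (Ioo 0 ℓ))) (hτ : 0 < τ) (hτ1 : τ ≤ 1) (hτT : τ ≤ T)
    (hf : ∀ᵐ t ∂volume.restrict (Ioo 0 T),
      (wderiv D.f 1) t = g₀ + ∫ s in (0 : ℝ)..t, (wderiv D.f 2) s)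
    {v v' : SobolevH (H01H2 ℓ) 2 0 τ} {k k' : SobolevH ℝ 1 0 τ} {y y' : SobolevH ℝ 3 0 τ}
    (h : D.IsSolution v k y) (h' : D.IsSolution v' k' y') : v = v' ∧ k = k' := by
  have hzz := VolterraData.ae_eq_of_solution _ hτ.le hτ1
    (integrableOn_stateDeriv hτT v k y) (integrableOn_stateDeriv hτT v' k' y')
    (h.ae_eq_forcing_add_op hℓ hβ hψ hτ hτT hf) (h'.ae_eq_forcing_add_op hℓ hβ hψ hτ hτT hf)
  have hrep := h.represents hℓ hβ hψ hτ hτT hf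
  have hrep' := h'.represents hℓ hβ hψ hτ hτT hf
  have hprim : ∀ᵐ t ∂volume.restrict (Ioo 0 τ),
      (reduced hℓ hβ hψ g₀).volterra.prim (D.stateDeriv v k y) t
        = (reduced hℓ hβ hψ g₀).volterra.prim (D.stateDeriv v' k' y') t := by
    filter_upwards [ae_restrict_mem measurableSet_Ioo] with t hm
    rw [VolterraData.prim, VolterraData.prim, intervalIntegral_congr_ae_Ioo hzz
      (left_mem_Icc.2 hτ.le) (Ioo_subset_Icc_self hm)]
  constructor
  · refine SobolevH.ext fun j hj => Lp.ext ?_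
    interval_cases j
    · filter_upwards [hrep.v_zero, hrep'.v_zero, hprim] with t h1 h2 h3
      rw [h1, h2, h3]
    · filter_upwards [hzz] with t ht
      exact congrArg (fun z => z.1) ht
    · filter_upwards [hzz] with t ht
      exact congrArg (fun z => z.2.1) ht
  · refine SobolevH.ext fun j hj => Lp.ext ?_
    interval_cases j
    · filter_upwards [hrep.k_zero, hrep'.k_zero, hprim] with t h1 h2 h3
      rw [h1, h2, h3]
    · filter_upwards [hzz] with t ht
      exact congrArg (fun z => z.2.2.1) ht

theorem exists_isSolution_of_volterra (hτ : 0 < τ) (hτT : τ ≤ T)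
    (hf : ∀ᵐ t ∂volume.restrict (Ioo 0 T),
      (wderiv D.f 1) t = g₀ + ∫ s in (0 : ℝ)..t, (wderiv D.f 2) s)
    {z : ℝ → State (H01H2 ℓ)} (hz : MemLp z 2 (volume.restrict (Ioo 0 τ)))
    (h : ∀ t ∈ Icc 0 τ, z t
      = (reduced hℓ hβ hψ g₀).forcing (wderiv D.f 2) (wderiv D.f 4) t
        + (reduced hℓ hβ hψ g₀).volterra.op z t) :
    ∃ (v : SobolevH (H01H2 ℓ) 2 0 τ) (k : SobolevH ℝ 1 0 τ) (y : SobolevH ℝ 3 0 τ),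
      D.IsSolution v k y := by
  have := completeSpace_H01H2 hℓ
  have hzi : IntegrableOn z (Ioo 0 τ) := hz.integrable (by norm_num)
  set R := reduced hℓ hβ hψ g₀ with hR
  set U := R.volterra.prim z with hU
  have hUc : ContinuousOn U (Icc 0 τ) := VolterraData.continuousOn_prim _ hτ.le hzi
  have hcomp := fun t ht => (R.eq_forcing_add_op_iff _ _ hzi ht).1 (h t ht)
  rw [← hU] at hcomp
  have hUm : MemLp U 2 (volume.restrict (Ioo 0 τ)) := memLp_two_of_continuousOn hUc
  have hmem : ∀ᵐ t ∂volume.restrict (Ioo 0 τ), t ∈ Icc 0 τ := by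
    filter_upwards [ae_restrict_mem measurableSet_Ioo] with t ht using Ioo_subset_Icc_self ht
  have hV := (projV (H01H2 ℓ)).comp_memLp' hUm
  have hW := (projW (H01H2 ℓ)).comp_memLp' hUm
  have hA := (projW (H01H2 ℓ)).comp_memLp' hz
  have hK := (projK (H01H2 ℓ)).comp_memLp' hUm
  have hK' := (projK (H01H2 ℓ)).comp_memLp' hz
  have hY2 := (projY (H01H2 ℓ)).comp_memLp' hUm
  have hY3 := (projY (H01H2 ℓ)).comp_memLp' hz
  have hY2c : ContinuousOn (projY (H01H2 ℓ) ∘ U) (Icc 0 τ) :=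
    (projY (H01H2 ℓ)).continuous.comp_continuousOn hUc
  have hY1c := continuousOn_primitive_Ioo hτ.le (hY2c.integrableOn_Icc.mono_set Ioo_subset_Icc_self)
  have hY0c := continuousOn_primitive_Ioo hτ.le (hY1c.integrableOn_Icc.mono_set Ioo_subset_Icc_self)
  have hY1 := memLp_two_of_continuousOn hY1c
  have hY0 := memLp_two_of_continuousOn hY0c
  -- The first row of the Volterra equation, `z.1 = U.2.1`, makes the second component of the state
  -- the derivative of the first.
  have pV : ∀ᵐ t ∂volume.restrict (Ioo 0 τ), (projV (H01H2 ℓ) ∘ U) t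
      = D.v₀ + ∫ s in (0 : ℝ)..t, (projW (H01H2 ℓ) ∘ U) s := by
    filter_upwards [hmem] with t ht
    refine (R.map_prim (projV _) hzi ht).trans ?_
    congr 1
    refine intervalIntegral.integral_congr fun s hs => ?_
    rw [uIcc_of_le ht.1] at hs
    exact (hcomp s ⟨hs.1, hs.2.trans ht.2⟩).1
  have pW : ∀ᵐ t ∂volume.restrict (Ioo 0 τ), (projW (H01H2 ℓ) ∘ U) t
      = D.v₁ + ∫ s in (0 : ℝ)..t, (projW (H01H2 ℓ) ∘ z) s := by
    filter_upwards [hmem] with t ht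
    exact R.map_prim (projW _) hzi ht
  have pK : ∀ᵐ t ∂volume.restrict (Ioo 0 τ), (projK (H01H2 ℓ) ∘ U) t
      = D.kZero + ∫ s in (0 : ℝ)..t, (projK (H01H2 ℓ) ∘ z) s := by
    filter_upwards [hmem] with t ht
    exact R.map_prim (projK _) hzi ht
  have pY : ∀ᵐ t ∂volume.restrict (Ioo 0 τ), (projY (H01H2 ℓ) ∘ U) t
      = D.ySecondZero + ∫ s in (0 : ℝ)..t, (projY (H01H2 ℓ) ∘ z) s := by
    filter_upwards [hmem] with t ht
    exact R.map_prim (projY _) hzi ht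
  let v : SobolevH (H01H2 ℓ) 2 0 τ := SobolevH.mk ![hV.toLp, hW.toLp, hA.toLp] (by
    intro j
    fin_cases j
    · exact hasWeakDeriv_toLp hV hW _ pV
    · exact hasWeakDeriv_toLp hW hA _ pW)
  let k : SobolevH ℝ 1 0 τ := SobolevH.mk ![hK.toLp, hK'.toLp] (by
    intro j
    fin_cases j
    exact hasWeakDeriv_toLp hK hK' _ pK)
  -- `y'` and `y` are iterated primitives of `y''` starting from zero; any starting values would do,
  -- since only `y''` and `y'''` occur in the system.
  let y : SobolevH ℝ 3 0 τ := SobolevH.mk ![hY0.toLp, hY1.toLp, hY2.toLp, hY3.toLp] (by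
    intro j
    fin_cases j
    · exact hasWeakDeriv_toLp hY0 hY1 0 (Filter.Eventually.of_forall fun t => (zero_add _).symm)
    · exact hasWeakDeriv_toLp hY1 hY2 0 (Filter.Eventually.of_forall fun t => (zero_add _).symm)
    · exact hasWeakDeriv_toLp hY2 hY3 _ pY)
  have hrep : D.Represents z U v k y :=
    { v_zero := hV.coeFn_toLp
      v_one := hW.coeFn_toLp
      v_two := hA.coeFn_toLp
      k_zero := hK.coeFn_toLp
      k_one := hK'.coeFn_toLp
      y_two := hY2.coeFn_toLp
      y_three := hY3.coeFn_toLp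
      f_one := by
        filter_upwards [ae_of_lt hτT hf, hmem] with t ht hm
        rw [ht]
        refine Eq.trans ?_ (R.map_prim (projG _) hzi hm).symm
        have : ∫ s in (0 : ℝ)..t, (wderiv D.f 2) s = ∫ s in (0 : ℝ)..t, projG _ (z s) := by
          refine intervalIntegral.integral_congr fun s hs => ?_
          rw [uIcc_of_le hm.1] at hs
          exact (hcomp s ⟨hs.1, hs.2.trans hm.2⟩).2.2.2.2.symm
        rw [this]
        rfl }
  refine ⟨v, k, y, ?_, ?_, ?_, ?_, ?_, ?_, ?_⟩
  · filter_upwards [hrep.pde_iff hℓ hβ hψ g₀ hUc, hmem] with t ht hm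
    exact ht.2 (hcomp t hm).2.1
  · exact (hasValueAt_of_ae_eq_primitive hτ.le (hW.integrable (by norm_num)) pV).congr
      hV.coeFn_toLp.symm
  · exact (hasValueAt_of_ae_eq_primitive hτ.le (hA.integrable (by norm_num)) pW).congr
      hW.coeFn_toLp.symm
  · exact (hasValueAt_of_ae_eq_primitive hτ.le (hK'.integrable (by norm_num)) pK).congr
      hK.coeFn_toLp.symm
  · filter_upwards [hrep.k_iff hℓ hβ hψ g₀, hmem] with t ht hm
    exact ht.2 (hcomp t hm).2.2.1
  · exact (hasValueAt_of_ae_eq_primitive hτ.le (hY3.integrable (by norm_num)) pY).congr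
      hY2.coeFn_toLp.symm
  · filter_upwards [hrep.y_iff hℓ hβ hψ g₀, hmem] with t ht hm
    exact ht.2 (hcomp t hm).2.2.2.1

end Data

end AcousticInverse

end

theorem theorem4p1 (ℓ T : ℝ) (hℓ : 0 < ℓ) (hT : 0 < T) (D : Data ℓ T) (hD : D.Admissible) :
    ∃ τ : ℝ, 0 < τ ∧ τ < T ∧
      ∃! vk : SobolevH (H01H2 ℓ) 2 0 τ × SobolevH ℝ 1 0 τ,
        ∃ y : SobolevH ℝ 3 0 τ, D.IsSolution vk.1 vk.2 y := by
  have := completeSpace_H01H2 hℓ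
  have hψ := D.memLp_ψ hℓ hD.φ_mem
  -- `g₀` is the initial value of `f'`, taken as the constant of integration.
  obtain ⟨g₀, hf⟩ := exists_wderiv_ae_eq_primitive hT D.f 1 (by norm_num)
  let R := Data.reduced hℓ hD.β_pos hψ g₀
  have hc : MemLp (R.forcing (wderiv D.f 2) (wderiv D.f 4)) 2 (volume.restrict (Ioo 0 T)) :=
    R.memLp_forcing (Lp.memLp _) (Lp.memLp _)
  obtain ⟨τ, hτ, hτT, hτ1, w, hw, hsol⟩ :=
    R.volterra.exists_solution hT (hc.integrable (by norm_num))
  have hcτ : MemLp (R.forcing (wderiv D.f 2) (wderiv D.f 4)) 2 (volume.restrict (Ioo 0 τ)) :=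
    hc.mono_measure (Measure.restrict_mono (Ioo_subset_Ioo_right hτT.le) le_rfl)
  obtain ⟨v, k, y, hvky⟩ := Data.exists_isSolution_of_volterra hℓ hD.β_pos hψ hτ hτT.le hf
    (hcτ.add (memLp_two_of_continuousOn hw.continuousOn)) fun t ht => by
      rw [Pi.add_apply, hsol t ht]
      rfl
  refine ⟨τ, hτ, hτT, (v, k), ⟨y, hvky⟩, ?_⟩
  rintro ⟨v', k'⟩ ⟨y', h'⟩
  obtain ⟨h1, h2⟩ := h'.unique hℓ hD.β_pos hψ hτ hτ1 hτT.le hf hvky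
  exact Prod.ext h1 h2
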